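/- Conventions. A schema is a family of relation symbols with arities. A rule is an existential rule $\forall\bar x\,\forall\bar y\,(\varphi(\bar x,\bar y)\to\exists\bar z\,\psi(\bar x,\bar z))$, where $\varphi$ (the body) and $\psi$ (the head) are finite conjunctions of atoms with constants and variables as arguments. Bodies may also use atoms $\mathrm{Dom}(t)$ of a built-in unary predicate, which holds exactly of the constants occurring in the input database. Heads do not use $\mathrm{Dom}$. Let $\Sigma$ be a set of rules. The set of affected positions of $\Sigma$ is the least set of positions (pairs of a relation symbol and an argument index, never the position of $\mathrm{Dom}$) that contains (i) every head position of an existentially quantified variable of a rule of $\Sigma$ and (ii) every head position of a body variable of a rule of $\Sigma$ all of whose body occurrences are at affected positions. A body variable of a rule is harmful if all its body occurrences are at affected positions, and harmless otherwise; a harmful variable that occurs in the head is dangerous. $\Sigma$ is Warded if every rule of $\Sigma$ with a dangerous variable has a body atom (a ward) that contains all its dangerous variables and shares only harmless variables with the other body atoms. A harmful join rule is a rule in which two distinct body atoms share a harmful variable. $\Sigma$ is Harmless Warded if it is Warded and contains no harmful join rule. A database $D$ over a schema is a set of facts whose arguments are constants. The result $\Sigma(D)$ of the (semi-oblivious) chase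 is the least set of facts over constants and labelled nulls that contains $D$ and is closed under firing rules: whenever $\theta$ maps the body of $\rho\in\Sigma$ into the set (together with the facts $\mathrm{Dom}(c)$ for the constants $c$ of $D$), the head atoms instantiated by $\theta$ belong to the set, where each existential variable $z$ of $\rho$ is sent to a labelled null that is determined by $\rho$, $z$ and the restriction of $\theta$ to the body variables occurring in the head, different such data giving different nulls. Theorem. For every finite Warded Datalog$^\pm$ set of rules $\Sigma$ over a schema $S$ (in particular, for every one that contains harmful join rules) there exist finitely many auxiliary relation symbols and a finite Harmless Warded Datalog$^\pm$ set of rules $\Sigma'$ over $S$ extended by these symbols such that $\Sigma'$ is equivalent to $\Sigma$: for every database $D$ over $S$, $\Sigma(D)=\Sigma'(D)$, in the sense that the facts of $\Sigma'(D)$ over the symbols of $S$ are exactly the facts of $\Sigma(D)$, up to an injective renaming of the labelled nulls that fixes all constants. -/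

import Mathlib

namespace DatalogPM

universe u v w

/-- A relational schema: relation symbols with arities. -/
structure Schema where
  Rel : Type u
  arity : Rel → ℕ

/-- Atoms `R(t₁, …, tₙ)` with arguments in `X`.  With `X` a type of terms these are the atoms of
rules, with `X` a type of values they are facts. -/
structure Atom (S : Schema.{u}) (X : Type v) where
  rel : S.Rel
  args : Fin (S.arity rel) → X

/-- Replace every argument of an atom by its image under `f`. -/
def Atom.map {S : Schema.{u}} {X : Type v} {Y : Type w} (f : X → Y) (a : Atom S X) : Atom S Y :=
  ⟨a.rel, fun i => f (a.args i)⟩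

/-- The values that occur in a set of facts. -/
def activeDomain {S : Schema.{u}} {X : Type v} (I : Set (Atom S X)) : Set X :=
  {c | ∃ F ∈ I, ∃ i, F.args i = c}

/-- Terms of rules: constants and variables. -/
inductive Term (C : Type v) where
  | const (c : C)
  | var (x : ℕ)

/-- Body atoms: relational atoms, and atoms `Dom(t)` of the built-in predicate `Dom`, which ranges
over the constants of the input database. -/
inductive BodyAtom (S : Schema.{u}) (C : Type v) where
  | rel (a : Atom S (Term C))
  | dom (t : Term C)

/-- The variable `x` occurs in the body atom. -/
def BodyAtom.HasVar {S : Schema.{u}} {C : Type v} : BodyAtom S C → ℕ → Prop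
  | .rel a, x => ∃ i, a.args i = .var x
  | .dom t, x => t = .var x

/-- An existential rule `∀ x y (φ(x, y) → ∃ z ψ(x, z))`: `body` is the conjunction `φ`, `head` the
conjunction `ψ`.  Variables that occur in the body are universally quantified, the other variables
of the head are existentially quantified. -/
structure Rule (S : Schema.{u}) (C : Type v) where
  body : List (BodyAtom S C)
  head : List (Atom S (Term C))

section Rules

variable {S : Schema.{u}} {C : Type v}

/-- The variable `x` occurs in the body of the rule. -/
def Rule.InBody (r : Rule S C) (x : ℕ) : Prop := ∃ a ∈ r.body, a.HasVar x

/-- The variable `x` occurs in the head of the rule. -/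
def Rule.InHead (r : Rule S C) (x : ℕ) : Prop := ∃ a ∈ r.head, ∃ i, a.args i = .var x

/-- The frontier of a rule: the universally quantified variables that occur in the head. -/
def Rule.Frontier (r : Rule S C) (x : ℕ) : Prop := r.InBody x ∧ r.InHead x

/-- Affected positions of a set of rules: the least set of positions `(R, i)` that contains the
head positions of existential variables, and the head positions of those universal variables whose
body occurrences are all at affected positions.  The position of `Dom` is never affected. -/
inductive Affected (P : Set (Rule S C)) : (R : S.Rel) → Fin (S.arity R) → Prop
  | existential (r : Rule S C) (hr : r ∈ P) (a : Atom S (Term C)) (ha : a ∈ r.head)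
      (i : Fin (S.arity a.rel)) (x : ℕ) (hx : a.args i = .var x) (hex : ¬ r.InBody x) :
      Affected P a.rel i
  | propagate (r : Rule S C) (hr : r ∈ P) (a : Atom S (Term C)) (ha : a ∈ r.head)
      (i : Fin (S.arity a.rel)) (x : ℕ) (hx : a.args i = .var x) (hbody : r.InBody x)
      (hrel : ∀ b : Atom S (Term C), BodyAtom.rel b ∈ r.body →
        ∀ j, b.args j = .var x → Affected P b.rel j)
      (hdom : BodyAtom.dom (.var x) ∉ r.body) :
      Affected P a.rel i

/-- A variable of the body of `r` is harmful if it occurs in the body only at affected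
positions. -/
def Harmful (P : Set (Rule S C)) (r : Rule S C) (x : ℕ) : Prop :=
  r.InBody x ∧
  (∀ b : Atom S (Term C), BodyAtom.rel b ∈ r.body →
    ∀ j, b.args j = .var x → Affected P b.rel j) ∧
  BodyAtom.dom (.var x) ∉ r.body

/-- A harmful variable that occurs in the head is dangerous. -/
def Dangerous (P : Set (Rule S C)) (r : Rule S C) (x : ℕ) : Prop :=
  Harmful P r x ∧ r.InHead x

/-- A set of rules is warded if every rule either has no dangerous variable, or has a body atom
(a ward) that contains all its dangerous variables and shares only harmless variables with the
other body atoms. -/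
def Warded (P : Set (Rule S C)) : Prop :=
  ∀ r ∈ P, (∀ x, ¬ Dangerous P r x) ∨
    ∃ W ∈ r.body, (∀ x, Dangerous P r x → W.HasVar x) ∧
      ∀ B ∈ r.body, B ≠ W → ∀ x, W.HasVar x → B.HasVar x → ¬ Harmful P r x

/-- A harmful join rule: two distinct body atoms share a harmful variable. -/
def HarmfulJoinRule (P : Set (Rule S C)) (r : Rule S C) : Prop :=
  ∃ A ∈ r.body, ∃ B ∈ r.body, A ≠ B ∧ ∃ x, A.HasVar x ∧ B.HasVar x ∧ Harmful P r x

/-- Harmless Warded sets of rules: warded, and without harmful join rules. -/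
def HarmlessWarded (P : Set (Rule S C)) : Prop :=
  Warded P ∧ ∀ r ∈ P, ¬ HarmfulJoinRule P r

end Rules

/-- Values of the chase: constants and labelled nulls.  The null `null r z σ` is the witness that
the rule `r` invents for its existential variable `z` when its frontier is instantiated by `σ`. -/
inductive Val (S : Schema.{u}) (C : Type v) where
  | const (c : C)
  | null (r : Rule S C) (z : ℕ) (σ : {x : ℕ // r.Frontier x} → Val S C)

section Chase

variable {S : Schema.{u}} {C : Type v}

/-- The value is a labelled null. -/
def Val.IsNull : Val S C → Prop
  | .const _ => False
  | .null _ _ _ => True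

/-- The value of a term under an assignment of the variables. -/
def Term.eval (θ : ℕ → Val S C) : Term C → Val S C
  | .const c => .const c
  | .var x => θ x

open Classical in
/-- The extension of an assignment of the universal variables of `r` that sends the existential
variables to the nulls invented by `r`. -/
noncomputable def Rule.extend (r : Rule S C) (θ : ℕ → Val S C) : ℕ → Val S C :=
  fun x => if r.InBody x then θ x else .null r x (fun y => θ y.1)

/-- `Chase P D F`: the fact `F` belongs to the result `P(D)` of the (semi-oblivious) chase of the
database `D`, a set of facts over constants, with the rules `P`.  The chase starts from `D`; each
rule is fired for every assignment `θ` that maps its body into the facts obtained so far and the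
facts `Dom(c)`, `c` a constant of `D`, and it then adds the instantiated head atoms. -/
inductive Chase (P : Set (Rule S C)) (D : Set (Atom S C)) : Atom S (Val S C) → Prop
  | database (F : Atom S C) (hF : F ∈ D) : Chase P D (F.map Val.const)
  | step (r : Rule S C) (hr : r ∈ P) (θ : ℕ → Val S C)
      (hrel : ∀ b : Atom S (Term C), BodyAtom.rel b ∈ r.body → Chase P D (b.map (Term.eval θ)))
      (hdom : ∀ t : Term C, BodyAtom.dom t ∈ r.body →
        ∃ c ∈ activeDomain D, Term.eval θ t = Val.const c)
      (a : Atom S (Term C)) (ha : a ∈ r.head) :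
      Chase P D (a.map (Term.eval (r.extend θ)))

/-- The result `P(D)` of the chase, as a set of facts. -/
def chase (P : Set (Rule S C)) (D : Set (Atom S C)) : Set (Atom S (Val S C)) :=
  {F | Chase P D F}

end Chase

/-- The schema `S` with `k` auxiliary relation symbols added, of arities `ar`. -/
def Schema.withAux (S : Schema.{u}) {k : ℕ} (ar : Fin k → ℕ) : Schema.{u} where
  Rel := S.Rel ⊕ Fin k
  arity := Sum.elim S.arity ar

/-- An atom over `S`, seen over a schema with auxiliary symbols. -/
def Atom.lift {S : Schema.{u}} {X : Type v} {k : ℕ} (ar : Fin k → ℕ) (a : Atom S X) :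
    Atom (S.withAux ar) X :=
  ⟨Sum.inl a.rel, a.args⟩

/-- Two sets of facts over `S`, with possibly different supplies of nulls, are equal up to a
renaming of nulls: a map that fixes the constants, sends nulls to nulls and is injective on the
values occurring in `I` maps `I` onto `J`. -/
def EqualUpToNulls {S S₁ S₂ : Schema.{u}} {C : Type v}
    (I : Set (Atom S (Val S₁ C))) (J : Set (Atom S (Val S₂ C))) : Prop :=
  ∃ f : Val S₁ C → Val S₂ C,
    (∀ c, f (.const c) = .const c) ∧ (∀ n, n.IsNull → (f n).IsNull) ∧
    Set.InjOn f (activeDomain I) ∧ Atom.map f '' I = J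

/-- A set of rules `P` over `S` and a set of rules `P'` over `S` with auxiliary relation symbols
are equivalent: for every database `D` over `S`, the facts over `S` in `P'(D)` are those of `P(D)`,
up to a renaming of nulls. -/
def Equivalent {S : Schema.{u}} {C : Type v} {k : ℕ} {ar : Fin k → ℕ}
    (P : Set (Rule S C)) (P' : Set (Rule (S.withAux ar) C)) : Prop :=
  ∀ D : Set (Atom S C),
    EqualUpToNulls (chase P D) {F | F.lift ar ∈ chase P' (Atom.lift ar '' D)}

end DatalogPM

/-!
A rule joins on a harmful variable only to find out which constants its harmless variables can
take. Indeed all dangerous variables of a rule `r` lie in its ward, and the ward shares only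
harmless variables, which take constant values, with the rest of the body. Hence the body of `r`
may be replaced by the ward together with one auxiliary atom that holds of the values of the
harmless variables of `r` in the matches of its body (`Rewriting.rule`,
`IsWardList.bodyHolds_glue`). The frontier stays the same, so the nulls of the two chases
correspond (`Rewriting.tr`); the auxiliary symbol differs from rule to rule, so the correspondence
is injective. As auxiliary atoms only ever hold constants, their positions are not affected, and
the rewritten rules are warded and free of harmful joins.

It remains to derive the auxiliary facts by plain Datalog rules, without looking at nulls. To this
end there are further auxiliary symbols, one for each *pattern*: a conjunctive query of bounded
size, whose existential variables take the place of nulls. The Datalog rules are not written down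
one by one. All rules within a size bound are taken that are correct, over every database, for the
intended meaning of the auxiliary symbols (`Rewriting.auxRules`). There are finitely many of them,
and soundness holds by definition.

For completeness (`Rewriting.derives_of_subset_chaseLevel`), let `Φ` be a set of at most `N` facts
of the chase, where `N` bounds the lengths of bodies. Take a fact of `Φ` from the latest round,
produced by firing `r` with `θ`. All facts of `Φ` in which a null of this firing occurs belong to
the firing (`mem_headInst_of_null`). Replacing the facts of the firing by the image of the ward of
`r` therefore yields a set that is no larger and has fewer facts of the latest round. A
homomorphism from this set to any chase, combined with any match of the body of `r` that agrees
with it on harmless variables, yields a homomorphism from `Φ` (`Rewriting.exists_hom_of_resolve`).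
So the pattern of `Φ` follows, by a correct rule, from the pattern of the new set and the
auxiliary atom of `r`, which in turn follows from the pattern of the body facts of the firing.
-/

namespace DatalogPM

universe u v w

/-! ### Firings and rounds of the chase -/

section Basic

variable {S : Schema.{u}} {C : Type v}

theorem Atom.map_congr {X : Type v} {Y : Type w} {f g : X → Y} {a : Atom S X}
    (h : ∀ i, f (a.args i) = g (a.args i)) : a.map f = a.map g := by
  simp only [Atom.map, funext h]

theorem Atom.mk_congr {X : Type v} {T : S.Rel} {u u' : Fin (S.arity T) → X}
    (h : ∀ i, u i = u' i) : (⟨T, u⟩ : Atom S X) = ⟨T, u'⟩ := by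
  rw [funext h]

/-- A valuation `θ` maps the body of `r` into the set of facts `I` and the facts `Dom(c)`, `c` a
constant of `D`. -/
def Rule.BodyHolds (r : Rule S C) (I : Set (Atom S (Val S C))) (D : Set (Atom S C))
    (θ : ℕ → Val S C) : Prop :=
  (∀ b : Atom S (Term C), BodyAtom.rel b ∈ r.body → b.map (Term.eval θ) ∈ I) ∧
  ∀ t : Term C, BodyAtom.dom t ∈ r.body → ∃ c ∈ activeDomain D, Term.eval θ t = Val.const c

/-- The facts produced by firing `r` with `θ`. -/
def Rule.headInst (r : Rule S C) (θ : ℕ → Val S C) : Set (Atom S (Val S C)) :=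
  {F | ∃ a ∈ r.head, F = a.map (Term.eval (r.extend θ))}

theorem Rule.extend_of_inBody {r : Rule S C} {θ : ℕ → Val S C} {x : ℕ} (h : r.InBody x) :
    r.extend θ x = θ x := if_pos h

theorem Rule.extend_of_not_inBody {r : Rule S C} {θ : ℕ → Val S C} {x : ℕ} (h : ¬ r.InBody x) :
    r.extend θ x = .null r x (fun y => θ y.1) := if_neg h

theorem chase_of_bodyHolds {P : Set (Rule S C)} {D : Set (Atom S C)} {r : Rule S C} (hr : r ∈ P)
    {θ : ℕ → Val S C} (h : r.BodyHolds (chase P D) D θ) : r.headInst θ ⊆ chase P D := by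
  rintro F ⟨a, ha, rfl⟩
  exact Chase.step r hr θ h.1 h.2 a ha

/-- The facts produced by a firing depend only on the values of the frontier. -/
theorem Rule.headInst_congr {r : Rule S C} {θ θ' : ℕ → Val S C}
    (h : ∀ x, r.Frontier x → θ x = θ' x) : r.headInst θ = r.headInst θ' := by
  have key : ∀ a ∈ r.head,
      a.map (Term.eval (r.extend θ)) = a.map (Term.eval (r.extend θ')) := by
    intro a ha
    refine Atom.map_congr fun i => ?_
    rcases hx : a.args i with c | x
    · rfl
    · simp only [Term.eval]
      by_cases hb : r.InBody x
      · rw [extend_of_inBody hb, extend_of_inBody hb]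
        exact h x ⟨hb, a, ha, i, hx⟩
      · rw [extend_of_not_inBody hb, extend_of_not_inBody hb]
        congr 1
        funext y
        exact h y.1 y.2
  ext F
  constructor
  · rintro ⟨a, ha, rfl⟩
    exact ⟨a, ha, key a ha⟩
  · rintro ⟨a, ha, rfl⟩
    exact ⟨a, ha, (key a ha).symm⟩

/-- A null is not among the values of the frontier that determine it. -/
theorem Val.frontier_ne_null (r : Rule S C) (z : ℕ) (σ : {x : ℕ // r.Frontier x} → Val S C)
    (y : {x : ℕ // r.Frontier x}) : σ y ≠ .null r z σ := by
  suffices h : ∀ (v : Val S C) (r : Rule S C) (z : ℕ) (σ : {x : ℕ // r.Frontier x} → Val S C) (y),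
      v = .null r z σ → σ y ≠ v from fun hv => h _ r z σ y rfl hv
  intro v
  induction v with
  | const c => intro r z σ y h; cases h
  | null r' z' σ' ih =>
    intro r z σ y h hv
    cases h
    exact ih y r' z' σ' y hv rfl

noncomputable instance : Inhabited (Val S C) :=
  ⟨.null ⟨[], []⟩ 0 fun y => absurd y.2.1 fun ⟨_, hb, _⟩ => List.not_mem_nil hb⟩

/-- The constant that a value is, if it is one. -/
def Val.const? : Val S C → Option C
  | .const c => some c
  | .null _ _ _ => none

theorem Val.const?_eq_some {v : Val S C} {c : C} : v.const? = some c ↔ v = .const c := by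
  cases v <;> simp [Val.const?]

/-- Only constants occur at positions that are not affected. -/
theorem Chase.const_of_not_affected {P : Set (Rule S C)} {D : Set (Atom S C)}
    {F : Atom S (Val S C)} (h : Chase P D F) :
    ∀ i, ¬ Affected P F.rel i → ∃ c, F.args i = .const c := by
  induction h with
  | database F hF => exact fun i _ => ⟨_, rfl⟩
  | step r hr θ hrel hdom a ha ih =>
    intro i hi
    rcases hx : a.args i with c | x
    · exact ⟨c, by simp [Atom.map, hx, Term.eval]⟩
    · by_cases hb : r.InBody x
      · have hval : (a.map (Term.eval (r.extend θ))).args i = θ x := by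
          simp [Atom.map, hx, Term.eval, Rule.extend_of_inBody hb]
        rw [hval]
        by_contra hc
        refine hi (Affected.propagate r hr a ha i x hx hb (fun b hbm j hj => ?_) fun hd => ?_)
        · by_contra hna
          obtain ⟨c, hc'⟩ := ih b hbm j hna
          exact hc ⟨c, by simpa [Atom.map, hj, Term.eval] using hc'⟩
        · obtain ⟨c, -, hc'⟩ := hdom _ hd
          exact hc ⟨c, hc'⟩
      · exact absurd (Affected.existential r hr a ha i x hx hb) hi

theorem const_of_not_harmful {P : Set (Rule S C)} {D : Set (Atom S C)} {r : Rule S C}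
    {θ : ℕ → Val S C} (h : r.BodyHolds (chase P D) D θ) {x : ℕ} (hx : r.InBody x)
    (hh : ¬ Harmful P r x) : ∃ c, θ x = .const c := by
  by_contra hc
  refine hh ⟨hx, fun b hb j hj => ?_, fun hd => ?_⟩
  · by_contra hna
    obtain ⟨c, hc'⟩ := Chase.const_of_not_affected (h.1 b hb) j hna
    exact hc ⟨c, by simpa [Atom.map, hj, Term.eval] using hc'⟩
  · obtain ⟨c, -, hc'⟩ := h.2 _ hd
    exact hc ⟨c, hc'⟩

end Basic

section Levels

variable {S : Schema.{u}} {C : Type v} (P : Set (Rule S C)) (D : Set (Atom S C))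

/-- The facts obtained after `n` parallel rounds of the chase. -/
def chaseLevel : ℕ → Set (Atom S (Val S C))
  | 0 => Atom.map Val.const '' D
  | n + 1 => chaseLevel n ∪ {F | ∃ r ∈ P, ∃ θ, r.BodyHolds (chaseLevel n) D θ ∧ F ∈ r.headInst θ}

theorem chaseLevel_mono : Monotone (chaseLevel P D) :=
  monotone_nat_of_le_succ fun _ => Set.subset_union_left

variable {P D}

theorem Rule.BodyHolds.mono {r : Rule S C} {I J : Set (Atom S (Val S C))} {θ : ℕ → Val S C}
    (h : r.BodyHolds I D θ) (hIJ : I ⊆ J) : r.BodyHolds J D θ :=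
  ⟨fun b hb => hIJ (h.1 b hb), h.2⟩

theorem chaseLevel_subset_chase (n : ℕ) : chaseLevel P D n ⊆ chase P D := by
  induction n with
  | zero =>
    rintro _ ⟨F, hF, rfl⟩
    exact Chase.database F hF
  | succ n ih =>
    rintro F (hF | ⟨r, hr, θ, hb, hF⟩)
    · exact ih hF
    · exact chase_of_bodyHolds hr (hb.mono ih) hF

theorem exists_bodyHolds_chaseLevel {r : Rule S C} {θ : ℕ → Val S C}
    (hrel : ∀ b : Atom S (Term C), BodyAtom.rel b ∈ r.body →
      ∃ n, b.map (Term.eval θ) ∈ chaseLevel P D n)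
    (hdom : ∀ t : Term C, BodyAtom.dom t ∈ r.body →
      ∃ c ∈ activeDomain D, Term.eval θ t = Val.const c) :
    ∃ n, r.BodyHolds (chaseLevel P D n) D θ := by
  suffices h : ∀ l : List (BodyAtom S C), (∀ b : Atom S (Term C), BodyAtom.rel b ∈ l →
      ∃ n, b.map (Term.eval θ) ∈ chaseLevel P D n) →
      ∃ n, ∀ b : Atom S (Term C), BodyAtom.rel b ∈ l → b.map (Term.eval θ) ∈ chaseLevel P D n by
    obtain ⟨n, hn⟩ := h r.body hrel
    exact ⟨n, hn, hdom⟩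
  intro l
  induction l with
  | nil => simp
  | cons a l ih =>
    intro h
    obtain ⟨n, hn⟩ := ih fun b hb => h b (List.mem_cons_of_mem _ hb)
    cases a with
    | dom t => exact ⟨n, fun b hb => hn b (by simpa using hb)⟩
    | rel a =>
      obtain ⟨m, hm⟩ := h a (by simp)
      refine ⟨max n m, fun b hb => ?_⟩
      rcases List.mem_cons.1 hb with hb | hb
      · cases hb
        exact chaseLevel_mono P D (le_max_right _ _) hm
      · exact chaseLevel_mono P D (le_max_left _ _) (hn b hb)

theorem exists_mem_chaseLevel {F : Atom S (Val S C)} (h : Chase P D F) :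
    ∃ n, F ∈ chaseLevel P D n := by
  induction h with
  | database F hF => exact ⟨0, F, hF, rfl⟩
  | step r hr θ hrel hdom a ha ih =>
    obtain ⟨n, hn⟩ := exists_bodyHolds_chaseLevel ih hdom
    exact ⟨n + 1, Or.inr ⟨r, hr, θ, hn, a, ha, rfl⟩⟩

theorem Rule.BodyHolds.exists_chaseLevel {r : Rule S C} {θ : ℕ → Val S C}
    (h : r.BodyHolds (chase P D) D θ) : ∃ n, r.BodyHolds (chaseLevel P D n) D θ :=
  exists_bodyHolds_chaseLevel (fun b hb => exists_mem_chaseLevel (h.1 b hb)) h.2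

/-- A null is born with all the facts of its firing: a fact in which it occurs is one of these, or
all of them were produced in an earlier round. -/
theorem headInst_of_null_succ {n : ℕ} {G : Atom S (Val S C)} (hG : G ∈ chaseLevel P D (n + 1))
    {i : Fin (S.arity G.rel)} {r : Rule S C} {z : ℕ} {θ : ℕ → Val S C}
    (hi : G.args i = .null r z fun y => θ y.1)
    (hn : ∀ G ∈ chaseLevel P D n, ∀ i, G.args i = .null r z (fun y => θ y.1) →
      r.headInst θ ⊆ chaseLevel P D n) :
    (G ∈ r.headInst θ ∧ r.headInst θ ⊆ chaseLevel P D (n + 1)) ∨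
      r.headInst θ ⊆ chaseLevel P D n := by
  rcases hG with hG | ⟨r₁, hr₁, θ₁, hb, a, ha, rfl⟩
  · exact Or.inr (hn G hG i hi)
  · rcases hx : a.args i with c | x
    · simp [Atom.map, hx, Term.eval] at hi
    · simp only [Atom.map, hx, Term.eval] at hi
      by_cases hxb : r₁.InBody x
      · rw [Rule.extend_of_inBody hxb] at hi
        obtain ⟨b, hbm, hbx⟩ := hxb
        cases b with
        | dom t =>
          obtain ⟨c, -, hc⟩ := hb.2 t hbm
          have ht : t = .var x := hbx
          rw [ht, Term.eval, hi] at hc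
          cases hc
        | rel b =>
          obtain ⟨j, hj⟩ := hbx
          exact Or.inr (hn _ (hb.1 b hbm) j (by simpa [Atom.map, hj, Term.eval] using hi))
      · rw [Rule.extend_of_not_inBody hxb] at hi
        obtain ⟨rfl, rfl, hσ⟩ := Val.null.inj hi
        have hθ : ∀ y, r₁.Frontier y → θ₁ y = θ y := fun y hy => by
          simpa using congrFun (eq_of_heq hσ) ⟨y, hy⟩
        rw [← Rule.headInst_congr hθ]
        exact Or.inl ⟨⟨a, ha, rfl⟩, fun F hF => Or.inr ⟨r₁, hr₁, θ₁, hb, hF⟩⟩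

theorem headInst_subset_of_null {r : Rule S C} {z : ℕ} {θ : ℕ → Val S C} (n : ℕ) :
    ∀ G ∈ chaseLevel P D n, ∀ i, G.args i = .null r z (fun y => θ y.1) →
      r.headInst θ ⊆ chaseLevel P D n := by
  induction n with
  | zero =>
    rintro _ ⟨F, hF, rfl⟩ i hi
    simp [Atom.map] at hi
  | succ n ih =>
    intro G hG i hi
    rcases headInst_of_null_succ hG hi ih with h | h
    · exact h.2
    · exact h.trans (chaseLevel_mono P D n.le_succ)

/-- If some fact of a firing is new in round `n + 1`, then every fact of that round in which a null
of the firing occurs is a fact of the firing. -/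
theorem mem_headInst_of_null {n : ℕ} {F G : Atom S (Val S C)} {r : Rule S C} {θ : ℕ → Val S C}
    (hF : F ∈ r.headInst θ) (hFn : F ∉ chaseLevel P D n) (hG : G ∈ chaseLevel P D (n + 1))
    {i : Fin (S.arity G.rel)} {z : ℕ} (hi : G.args i = .null r z fun y => θ y.1) :
    G ∈ r.headInst θ := by
  rcases headInst_of_null_succ hG hi (headInst_subset_of_null n) with h | h
  · exact h.1
  · exact absurd (h hF) hFn

end Levels

/-! ### Patterns and wards -/

section Patterns

variable {S : Schema.{u}} {C : Type v}

theorem Rule.finite_inBody (r : Rule S C) : {x | r.InBody x}.Finite := by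
  have h : {x | r.InBody x} = ⋃ b ∈ {b | b ∈ r.body}, {x | b.HasVar x} := by
    ext x
    simp [Rule.InBody]
  rw [h]
  refine (List.finite_toSet r.body).biUnion fun b _ => ?_
  cases b with
  | dom t =>
    refine Set.Subsingleton.finite fun x hx y hy => ?_
    have h1 : t = .var x := hx
    have h2 : t = .var y := hy
    rw [h1] at h2
    cases h2
    rfl
  | rel a =>
    refine (Set.finite_iUnion fun i => ?_ : (⋃ i, {x | a.args i = .var x}).Finite).subset ?_
    · refine Set.Subsingleton.finite fun x hx y hy => ?_
      have h1 : a.args i = .var x := hx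
      rw [show a.args i = .var y from hy] at h1
      cases h1
      rfl
    · rintro x ⟨i, hi⟩
      exact Set.mem_iUnion.2 ⟨i, hi⟩

/-- The harmless variables of a rule, listed in some order. -/
noncomputable def harmlessVars (P : Set (Rule S C)) (r : Rule S C) : List ℕ :=
  (r.finite_inBody.subset fun _ hx => hx.1 :
    {x | r.InBody x ∧ ¬ Harmful P r x}.Finite).toFinset.toList

theorem mem_harmlessVars {P : Set (Rule S C)} {r : Rule S C} {x : ℕ} :
    x ∈ harmlessVars P r ↔ r.InBody x ∧ ¬ Harmful P r x := by
  simp [harmlessVars]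

/-- The queries that auxiliary relation symbols stand for.  A pattern is a conjunctive query whose
answer variables are `Sum.inl i` with `i < n` and whose existential variables are `Sum.inr i`.  The
query `body r` asks for the values of the harmless variables of `r` in a match of the body of
`r`. -/
inductive Query (S : Schema.{u}) (C : Type v) where
  | pattern (n : ℕ) (q : Set (Atom S (ℕ ⊕ ℕ)))
  | body (r : Rule S C)

/-- The number of answer variables of a query. -/
noncomputable def Query.arity (P : Set (Rule S C)) : Query S C → ℕ
  | .pattern n _ => n
  | .body r => (harmlessVars P r).length

/-- The tuple `c` of constants is an answer to the query over the chase of `D`. -/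
def Query.Holds (P : Set (Rule S C)) (D : Set (Atom S C)) {n : ℕ} (c : Fin n → C) :
    Query S C → Prop
  | .pattern _ q => ∃ h : ℕ ⊕ ℕ → Val S C, (∀ i, h (.inl i.1) = .const (c i)) ∧
      ∀ a ∈ q, a.map h ∈ chase P D
  | .body r => ∃ θ : ℕ → Val S C,
      (∀ (i : Fin n) (x : ℕ), (harmlessVars P r)[i.1]? = some x → θ x = .const (c i)) ∧
      r.BodyHolds (chase P D) D θ

/-- The values occurring in a finite set of facts. -/
noncomputable def factVals (Φ : Finset (Atom S (Val S C))) : List (Val S C) :=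
  Φ.toList.flatMap fun F => List.ofFn F.args

/-- The constants occurring in a finite set of facts. -/
noncomputable def factConsts (Φ : Finset (Atom S (Val S C))) : List C :=
  (factVals Φ).filterMap Val.const?

theorem mem_factVals {Φ : Finset (Atom S (Val S C))} {v : Val S C} :
    v ∈ factVals Φ ↔ ∃ F ∈ Φ, ∃ i, F.args i = v := by
  simp [factVals, List.mem_ofFn]

theorem mem_factConsts {Φ : Finset (Atom S (Val S C))} {c : C} :
    c ∈ factConsts Φ ↔ ∃ F ∈ Φ, ∃ i, F.args i = .const c := by
  simp [factConsts, Val.const?_eq_some, mem_factVals]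

theorem length_factVals_le {Φ : Finset (Atom S (Val S C))} {n m : ℕ} (hΦ : Φ.card ≤ n)
    (hm : ∀ F ∈ Φ, S.arity F.rel ≤ m) : (factVals Φ).length ≤ n * m := by
  rw [factVals, List.length_flatMap]
  refine (List.sum_le_card_nsmul _ m ?_).trans ?_
  · intro k hk
    obtain ⟨F, hF, rfl⟩ := List.mem_map.1 hk
    simpa using hm F (by simpa using hF)
  · simpa using Nat.mul_le_mul_right m hΦ

theorem length_factConsts_le (Φ : Finset (Atom S (Val S C))) :
    (factConsts Φ).length ≤ (factVals Φ).length := List.length_filterMap_le _ _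

open Classical in
/-- The abstraction of the values occurring in `Φ`: constants become answer variables, nulls become
existential variables. -/
noncomputable def encode (Φ : Finset (Atom S (Val S C))) : Val S C → ℕ ⊕ ℕ
  | .const c => .inl ((factConsts Φ).idxOf c)
  | .null r z σ => .inr ((factVals Φ).idxOf (.null r z σ))

/-- The pattern of a finite set of facts; its answer variables stand for the constants of `Φ`, in
the order of `factConsts Φ`. -/
noncomputable def patternOf (Φ : Finset (Atom S (Val S C))) : Query S C :=
  .pattern (factConsts Φ).length (Atom.map (encode Φ) '' Φ)

/-- The pattern of `Φ` holds of the images of the constants of `Φ` under `γ` iff `Φ` has a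
homomorphism into the chase that extends `γ`. -/
theorem patternOf_holds_iff {P : Set (Rule S C)} {D : Set (Atom S C)}
    {Φ : Finset (Atom S (Val S C))} {n : ℕ} {c : Fin n → C}
    (hc : ∀ i, (factConsts Φ)[i.1]? = some (c i)) (hn : n = (factConsts Φ).length) (γ : C → C) :
    (patternOf Φ).Holds P D (γ ∘ c) ↔ ∃ f : Val S C → Val S C,
      (∀ c, f (.const c) = .const (γ c)) ∧ ∀ F ∈ Φ, F.map f ∈ chase P D := by
  classical
  constructor
  · rintro ⟨h, hh, hq⟩
    let f : Val S C → Val S C := fun v => (v.const?).elim (h (encode Φ v)) fun c => .const (γ c)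
    refine ⟨f, fun c => rfl, fun F hF => ?_⟩
    have := hq _ ⟨F, hF, rfl⟩
    convert this using 1
    refine Atom.map_congr (f := f) (g := fun v => h (encode Φ v)) fun i => ?_
    rcases hv : F.args i with d | ⟨r, z, σ⟩
    · have hd : d ∈ factConsts Φ := mem_factConsts.2 ⟨F, hF, i, hv⟩
      have hlt : (factConsts Φ).idxOf d < n := hn ▸ List.idxOf_lt_length_iff.2 hd
      have h1 := hh ⟨_, hlt⟩
      have h2 := hc ⟨_, hlt⟩
      rw [List.getElem?_idxOf hd, Option.some_inj] at h2
      simp only [encode]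
      rw [h1]
      simp [f, Val.const?, ← h2]
    · rfl
  · rintro ⟨f, hf, hΦ⟩
    let g : ℕ → Val S C := fun i => ((factConsts Φ)[i]?).elim default fun c => .const (γ c)
    let g' : ℕ → Val S C := fun i => ((factVals Φ)[i]?).elim default f
    refine ⟨Sum.elim g g', fun i => ?_, ?_⟩
    · simp [g, hc i]
    · rintro _ ⟨F, hF, rfl⟩
      convert hΦ F hF using 1
      refine Atom.map_congr (f := fun v => Sum.elim g g' (encode Φ v)) (g := f) fun i => ?_
      rcases hv : F.args i with d | ⟨r, z, σ⟩
      · have hd : d ∈ factConsts Φ := mem_factConsts.2 ⟨F, hF, i, hv⟩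
        simp [encode, g, List.getElem?_idxOf hd, hf]
      · have hd := mem_factVals.2 ⟨F, hF, i, hv⟩
        simp [encode, g', List.getElem?_idxOf hd]

end Patterns

section Wards

variable {S : Schema.{u}} {C : Type v} {P : Set (Rule S C)}

/-- `W` lists a ward of `r`, or is empty, so that it contains all dangerous variables of `r` and
shares only harmless variables with the rest of the body. -/
structure IsWardList (P : Set (Rule S C)) (r : Rule S C) (W : List (Atom S (Term C))) : Prop where
  length_le : W.length ≤ 1
  mem_body : ∀ a ∈ W, BodyAtom.rel a ∈ r.body
  of_dangerous : ∀ x, Dangerous P r x → ∃ a ∈ W, ∃ i, a.args i = .var x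
  not_harmful : ∀ a ∈ W, ∀ B ∈ r.body, B ≠ .rel a → ∀ x, (∃ i, a.args i = .var x) → B.HasVar x →
    ¬ Harmful P r x

theorem Warded.exists_isWardList (hP : Warded P) {r : Rule S C} (hr : r ∈ P) :
    ∃ W, IsWardList P r W := by
  by_cases hd : ∀ x, ¬ Dangerous P r x
  · exact ⟨[], by simp, by simp, fun x hx => absurd hx (hd x), by simp⟩
  · obtain ⟨W, hW, h1, h2⟩ := (hP r hr).resolve_left hd
    push Not at hd
    obtain ⟨x, hx⟩ := hd
    cases W with
    | dom t =>
      -- A variable of a `Dom` atom is harmless, so such an atom wards nothing.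
      have ht : t = .var x := h1 x hx
      exact absurd (ht ▸ hW) hx.1.2.2
    | rel a =>
      refine ⟨[a], by simp, by simpa using hW, fun y hy => ⟨a, by simp, h1 y hy⟩, ?_⟩
      intro b hb B hB hne y hy
      rw [List.mem_singleton] at hb
      subst hb
      exact h2 B hB hne y hy

theorem IsWardList.inBody {r : Rule S C} {W : List (Atom S (Term C))} (hW : IsWardList P r W)
    {a : Atom S (Term C)} (ha : a ∈ W) {i : Fin (S.arity a.rel)} {x : ℕ} (hi : a.args i = .var x) :
    r.InBody x := ⟨.rel a, hW.mem_body a ha, i, hi⟩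

/-- A frontier variable outside the ward is harmless. -/
theorem IsWardList.not_harmful_of_frontier {r : Rule S C} {W : List (Atom S (Term C))}
    (hW : IsWardList P r W) {x : ℕ} (hx : r.Frontier x)
    (h : ¬ ∃ a ∈ W, ∃ i, a.args i = .var x) : ¬ Harmful P r x :=
  fun hh => h (hW.of_dangerous x ⟨hh, hx.2⟩)

open Classical in
/-- The valuation that follows `θ` on the variables of the atoms `W` and `θ'` elsewhere. -/
noncomputable def glue (W : List (Atom S (Term C))) (θ θ' : ℕ → Val S C) : ℕ → Val S C :=
  fun x => if ∃ a ∈ W, ∃ i, a.args i = .var x then θ x else θ' x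

theorem glue_of_mem {W : List (Atom S (Term C))} {θ θ' : ℕ → Val S C} {x : ℕ}
    (h : ∃ a ∈ W, ∃ i, a.args i = .var x) : glue W θ θ' x = θ x := if_pos h

theorem glue_of_not_mem {W : List (Atom S (Term C))} {θ θ' : ℕ → Val S C} {x : ℕ}
    (h : ¬ ∃ a ∈ W, ∃ i, a.args i = .var x) : glue W θ θ' x = θ' x := if_neg h

theorem glue_eq_of_eq {W : List (Atom S (Term C))} {θ θ' : ℕ → Val S C} {x : ℕ}
    (h : θ x = θ' x) : glue W θ θ' x = θ' x := by
  unfold glue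
  split_ifs
  · exact h
  · rfl

/-- A match of the ward and a match of the body that agree on the harmless variables combine to a
match of the body.  This is what wardedness is for: the harmful values of the rest of the body
matter neither to the ward nor to the head. -/
theorem IsWardList.bodyHolds_glue {D : Set (Atom S C)} {r : Rule S C} {W : List (Atom S (Term C))}
    (hW : IsWardList P r W) {θ θ' : ℕ → Val S C} (hθ : ∀ a ∈ W, a.map (Term.eval θ) ∈ chase P D)
    (hθ' : r.BodyHolds (chase P D) D θ')
    (h : ∀ x, (∃ a ∈ W, ∃ i, a.args i = .var x) → ¬ Harmful P r x → θ x = θ' x) :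
    r.BodyHolds (chase P D) D (glue W θ θ') := by
  have key : ∀ B ∈ r.body, (∀ a ∈ W, B ≠ .rel a) → ∀ x, B.HasVar x → glue W θ θ' x = θ' x := by
    intro B hB hBW x hx
    by_cases hxW : ∃ a ∈ W, ∃ i, a.args i = .var x
    · obtain ⟨a, ha, hi⟩ := hxW
      exact glue_eq_of_eq (h x ⟨a, ha, hi⟩ (hW.not_harmful a ha B hB (hBW a ha) x hi hx))
    · exact glue_of_not_mem hxW
  constructor
  · intro b hb
    by_cases hbW : b ∈ W
    · convert hθ b hbW using 1
      refine Atom.map_congr fun i => ?_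
      rcases hx : b.args i with c | x
      · rfl
      · exact glue_of_mem ⟨b, hbW, i, hx⟩
    · convert hθ'.1 b hb using 1
      refine Atom.map_congr fun i => ?_
      rcases hx : b.args i with c | x
      · rfl
      · refine key _ hb (fun a ha hab => hbW ?_) x ⟨i, hx⟩
        cases hab
        exact ha
  · intro t ht
    obtain ⟨c, hc, hct⟩ := hθ'.2 t ht
    refine ⟨c, hc, ?_⟩
    cases t with
    | const d => exact hct
    | var x => exact (key _ ht (fun a _ hab => by cases hab) x rfl).trans hct

end Wards

/-! ### The rewritten program -/

section Rewriting

variable {S : Schema.{u}} {C : Type v}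

/-- A constant that occurs in a rule. -/
def Rule.HasConst (r : Rule S C) (c : C) : Prop :=
  (∃ a : Atom S (Term C), (.rel a ∈ r.body ∨ a ∈ r.head) ∧ ∃ i, a.args i = .const c) ∨
    .dom (.const c) ∈ r.body

/-- The choices behind the rewriting of `P`: a ward for every rule, the queries that the auxiliary
relation symbols stand for, and the size bounds that keep everything finite. -/
structure Rewriting (P : Set (Rule S C)) where
  /-- The number of auxiliary relation symbols. -/
  k : ℕ
  /-- The query that an auxiliary symbol stands for. -/
  query : Fin k → Query S C
  /-- The ward of a rule, as a list of at most one atom. -/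
  ward : Rule S C → List (Atom S (Term C))
  isWardList : ∀ r ∈ P, IsWardList P r (ward r)
  /-- The auxiliary symbol for the query `Query.body r`. -/
  sym : Rule S C → Fin k
  query_sym : ∀ r ∈ P, query (sym r) = .body r
  /-- The relation symbols that occur in bodies. -/
  rels : Set S.Rel
  finite_rels : rels.Finite
  rel_mem : ∀ r ∈ P, ∀ b : Atom S (Term C), .rel b ∈ r.body → b.rel ∈ rels
  /-- The constants that occur in rules. -/
  consts : Set C
  finite_consts : consts.Finite
  const_mem : ∀ r ∈ P, ∀ c, r.HasConst c → c ∈ consts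
  /-- The largest number of facts in a pattern. -/
  maxFacts : ℕ
  length_body_le : ∀ r ∈ P, r.body.length ≤ maxFacts
  /-- The largest number of values in the facts of a pattern. -/
  maxVals : ℕ
  length_vals_le : ∀ Φ : Finset (Atom S (Val S C)), Φ.card ≤ maxFacts → (∀ F ∈ Φ, F.rel ∈ rels) →
    (factVals Φ).length ≤ maxVals
  exists_query_pattern : ∀ Φ : Finset (Atom S (Val S C)), Φ.card ≤ maxFacts →
    (∀ F ∈ Φ, F.rel ∈ rels) → ∃ j, query j = patternOf Φ
  /-- The number of variables used in the rules for auxiliary symbols. -/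
  maxVars : ℕ
  maxVars_ge : ∀ r ∈ P, 2 * maxVals + maxFacts + (harmlessVars P r).length ≤ maxVars
  maxVals_le : maxVals ≤ maxVars

variable {P : Set (Rule S C)} (R : Rewriting P)

namespace Rewriting

/-- The arities of the auxiliary symbols. -/
noncomputable def ar (j : Fin R.k) : ℕ := (R.query j).arity P

/-- The schema with the auxiliary symbols. -/
noncomputable abbrev schema : Schema.{u} := S.withAux R.ar

/-- An atom of an auxiliary symbol. -/
def auxAtom {X : Type w} (j : Fin R.k) (v : Fin (R.ar j) → X) : Atom R.schema X := ⟨.inr j, v⟩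

/-- The atom that asks for the harmless variables of `r`. -/
noncomputable def harmlessAtom (r : Rule S C) : Atom R.schema (Term C) :=
  R.auxAtom (R.sym r) fun i => .var ((harmlessVars P r).getD i.1 0)

/-- The rewritten rule: the ward is kept, and the rest of the body is replaced by the auxiliary
atom for its harmless variables. -/
noncomputable def rule (r : Rule S C) : Rule R.schema C where
  body := (R.ward r).map (fun a => .rel (a.lift R.ar)) ++ [.rel (R.harmlessAtom r)]
  head := r.head.map (Atom.lift R.ar)

/-- The translation of the nulls of the chase of `P`. -/
noncomputable def tr : Val S C → Val R.schema C
  | .const c => .const c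
  | .null r z σ => .null (R.rule r) z
      (open Classical in fun y => if h : r.Frontier y.1 then tr (σ ⟨y.1, h⟩) else default)

/-- The intended meaning of the facts of the rewritten program over the database `D`: facts over
`S` are translations of facts of the chase of `P`, and auxiliary facts say that the query of their
symbol holds. -/
def Mean (D : Set (Atom S C)) : Atom R.schema (Val R.schema C) → Prop
  | ⟨.inl T, v⟩ => ∃ u : Fin (S.arity T) → Val S C, Chase P D ⟨T, u⟩ ∧ ∀ i, v i = R.tr (u i)
  | ⟨.inr j, v⟩ => ∃ c : Fin (R.ar j) → C, (∀ i, v i = .const (c i)) ∧ (R.query j).Holds P D c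

/-- The terms allowed in rules for auxiliary symbols. -/
def terms : Set (Term C) := Term.const '' R.consts ∪ Term.var '' Set.Iio R.maxVars

/-- The atoms allowed in rules for auxiliary symbols. -/
def atoms : Set (Atom R.schema (Term C)) :=
  {a | a.rel ∈ Sum.inl '' R.rels ∪ Set.range Sum.inr ∧ ∀ i, a.args i ∈ R.terms}

/-- The rules for the auxiliary symbols: all rules within the size bounds that are correct for the
intended meaning over every database, and all of whose variables occur in auxiliary or `Dom` atoms
of the body. -/
def auxRules : Set (Rule R.schema C) :=
  {ρ | ∃ s : Finset (BodyAtom R.schema C), ∃ a : Atom R.schema (Term C), ρ = ⟨s.toList, [a]⟩ ∧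
    (↑s ⊆ BodyAtom.rel '' R.atoms ∪ BodyAtom.dom '' R.terms) ∧ a ∈ R.atoms ∧ a.rel.isRight ∧
    (∀ x, (∃ b ∈ s, b.HasVar x) ∨ (∃ i, a.args i = .var x) →
      ∃ b ∈ s, b.HasVar x ∧ ∀ a' : Atom R.schema (Term C), b = .rel a' → a'.rel.isRight) ∧
    ∀ D θ, (∀ b, BodyAtom.rel b ∈ s → R.Mean D (b.map (Term.eval θ))) →
      (∀ t, BodyAtom.dom t ∈ s → ∃ c ∈ activeDomain D, Term.eval θ t = .const c) →
      R.Mean D (a.map (Term.eval θ))}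

/-- The rewritten program. -/
def program : Set (Rule R.schema C) := R.rule '' P ∪ R.auxRules

end Rewriting

theorem finite_setOf_atom {X : Type w} {A : Set S.Rel} (hA : A.Finite) {T : Set X}
    (hT : T.Finite) : {a : Atom S X | a.rel ∈ A ∧ ∀ i, a.args i ∈ T}.Finite := by
  refine (hA.biUnion fun r _ => (Set.Finite.pi' (fun _ : Fin (S.arity r) => hT)).image
    (Atom.mk r)).subset ?_
  rintro ⟨r, v⟩ ⟨hr, hv⟩
  exact Set.mem_biUnion hr ⟨v, hv, rfl⟩

namespace Rewriting

theorem finite_terms : R.terms.Finite :=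
  (R.finite_consts.image _).union ((Set.finite_Iio _).image _)

theorem finite_atoms : R.atoms.Finite :=
  finite_setOf_atom ((R.finite_rels.image _).union (Set.finite_range _)) R.finite_terms

theorem finite_program (hP : P.Finite) : R.program.Finite := by
  classical
  refine (hP.image _).union ?_
  have hB : (BodyAtom.rel '' R.atoms ∪ BodyAtom.dom '' R.terms :
      Set (BodyAtom R.schema C)).Finite := (R.finite_atoms.image _).union (R.finite_terms.image _)
  refine (Set.Finite.image (fun p : Finset (BodyAtom R.schema C) × Atom R.schema (Term C) =>
    (⟨p.1.toList, [p.2]⟩ : Rule R.schema C))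
    ((Finset.finite_toSet hB.toFinset.powerset).prod R.finite_atoms)).subset ?_
  rintro _ ⟨s, a, rfl, hs, ha, -⟩
  refine ⟨(s, a), ⟨?_, ha⟩, rfl⟩
  simpa [← Finset.coe_subset] using hs

variable {R}

theorem hasVar_harmlessAtom {r : Rule S C} (hr : r ∈ P) {x : ℕ} :
    (BodyAtom.rel (R.harmlessAtom r)).HasVar x ↔ x ∈ harmlessVars P r := by
  have hlen : R.ar (R.sym r) = (harmlessVars P r).length := by
    rw [ar, R.query_sym r hr, Query.arity]
  constructor
  · rintro ⟨i, hi⟩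
    have hi' : i.1 < (harmlessVars P r).length := hlen ▸ i.2
    have : (harmlessVars P r).getD i.1 0 = x := by
      simpa [harmlessAtom, auxAtom] using hi
    rw [← this, List.getD_eq_getElem _ _ hi']
    exact List.getElem_mem hi'
  · intro hx
    obtain ⟨i, hi, rfl⟩ := List.mem_iff_getElem.1 hx
    refine ⟨(⟨i, hlen ▸ hi⟩ : Fin (R.ar (R.sym r))), ?_⟩
    simp [harmlessAtom, auxAtom, List.getElem?_eq_getElem hi]

theorem mem_rule_body {r : Rule S C} {b : BodyAtom R.schema C} :
    b ∈ (R.rule r).body ↔ (∃ a ∈ R.ward r, b = .rel (a.lift R.ar)) ∨ b = .rel (R.harmlessAtom r) := by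
  simp [rule, eq_comm]

theorem rule_inBody {r : Rule S C} (hr : r ∈ P) {x : ℕ} :
    (R.rule r).InBody x ↔ (∃ a ∈ R.ward r, ∃ i, a.args i = .var x) ∨ x ∈ harmlessVars P r := by
  rw [← hasVar_harmlessAtom (R := R) hr]
  constructor
  · rintro ⟨b, hb, hx⟩
    rcases mem_rule_body.1 hb with ⟨a, ha, rfl⟩ | rfl
    · exact Or.inl ⟨a, ha, hx⟩
    · exact Or.inr hx
  · rintro (⟨a, ha, hx⟩ | hx)
    · exact ⟨_, mem_rule_body.2 (Or.inl ⟨a, ha, rfl⟩), hx⟩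
    · exact ⟨_, mem_rule_body.2 (Or.inr rfl), hx⟩

theorem rule_inHead {r : Rule S C} {x : ℕ} : (R.rule r).InHead x ↔ r.InHead x := by
  constructor
  · rintro ⟨_, ha, i, hi⟩
    obtain ⟨a, ha', rfl⟩ := List.mem_map.1 ha
    exact ⟨a, ha', i, hi⟩
  · rintro ⟨a, ha, i, hi⟩
    exact ⟨_, List.mem_map.2 ⟨a, ha, rfl⟩, i, hi⟩

theorem inBody_of_rule_inBody {r : Rule S C} (hr : r ∈ P) {x : ℕ} (h : (R.rule r).InBody x) :
    r.InBody x := by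
  rcases (rule_inBody hr).1 h with ⟨a, ha, i, hi⟩ | h
  · exact (R.isWardList r hr).inBody ha hi
  · exact (mem_harmlessVars.1 h).1

/-- A frontier variable outside the ward is harmless, so the rewriting loses no frontier
variable. -/
theorem rule_inBody_of_frontier {r : Rule S C} (hr : r ∈ P) {x : ℕ} (h : r.Frontier x) :
    (R.rule r).InBody x := by
  rw [rule_inBody hr]
  by_contra hc
  push Not at hc
  refine hc.2 (mem_harmlessVars.2 ⟨h.1, (R.isWardList r hr).not_harmful_of_frontier h ?_⟩)
  push Not
  exact hc.1

theorem rule_frontier {r : Rule S C} (hr : r ∈ P) {x : ℕ} :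
    (R.rule r).Frontier x ↔ r.Frontier x :=
  ⟨fun h => ⟨inBody_of_rule_inBody hr h.1, rule_inHead.1 h.2⟩,
    fun h => ⟨rule_inBody_of_frontier hr h, rule_inHead.2 h.2⟩⟩

/-- The positions of auxiliary symbols are not affected. -/
theorem isRight_eq_false_of_affected {T : R.schema.Rel} {i : Fin (R.schema.arity T)}
    (h : Affected R.program T i) : T.isRight = false := by
  induction h with
  | existential ρ hρ a ha i x hx hex =>
    rcases hρ with ⟨r, hr, rfl⟩ | ⟨s, a', rfl, -, -, -, hsafe, -⟩
    · obtain ⟨a, -, rfl⟩ := List.mem_map.1 ha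
      rfl
    · rw [List.mem_singleton] at ha
      subst ha
      obtain ⟨b, hb, hbx, -⟩ := hsafe x (Or.inr ⟨i, hx⟩)
      exact absurd ⟨b, by simpa using hb, hbx⟩ hex
  | propagate ρ hρ a ha i x hx hbody hrel hdom ih =>
    rcases hρ with ⟨r, hr, rfl⟩ | ⟨s, a', rfl, -, -, -, hsafe, -⟩
    · obtain ⟨a, -, rfl⟩ := List.mem_map.1 ha
      rfl
    · rw [List.mem_singleton] at ha
      subst ha
      obtain ⟨b, hb, hbx, hright⟩ := hsafe x (Or.inr ⟨i, hx⟩)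
      cases b with
      | dom t =>
        have ht : t = .var x := hbx
        exact absurd (by simpa [ht] using hb) hdom
      | rel b =>
        obtain ⟨j, hj⟩ := hbx
        have := ih b (by simpa using hb) j hj
        rw [hright b rfl] at this
        cases this

theorem not_harmful_of_isRight {ρ : Rule R.schema C} {a : Atom R.schema (Term C)}
    (ha : .rel a ∈ ρ.body) (hright : a.rel.isRight) {x : ℕ} (hx : (BodyAtom.rel a).HasVar x) :
    ¬ Harmful R.program ρ x := by
  rintro ⟨-, h, -⟩
  obtain ⟨i, hi⟩ := hx
  have := isRight_eq_false_of_affected (h a ha i hi)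
  rw [hright] at this
  cases this

theorem not_harmful_of_mem_auxRules {ρ : Rule R.schema C} (hρ : ρ ∈ R.auxRules) (x : ℕ) :
    ¬ Harmful R.program ρ x := by
  obtain ⟨s, a, rfl, -, -, -, hsafe, -⟩ := hρ
  intro hx
  obtain ⟨b, hb, hbx⟩ := hx.1
  obtain ⟨b, hb, hbx, hright⟩ := hsafe x (Or.inl ⟨b, by simpa using hb, hbx⟩)
  cases b with
  | dom t =>
    have ht : t = .var x := hbx
    exact hx.2.2 (by simpa [ht] using hb)
  | rel b => exact not_harmful_of_isRight (by simpa using hb) (hright b rfl) hbx hx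

variable (R) in
theorem harmlessWarded_program : HarmlessWarded R.program := by
  have hQ : ∀ r x, (BodyAtom.rel (R.harmlessAtom r)).HasVar x →
      ¬ Harmful R.program (R.rule r) x := fun r x hx =>
    not_harmful_of_isRight (mem_rule_body.2 (Or.inr rfl)) rfl hx
  constructor
  · rintro ρ (⟨r, hr, rfl⟩ | hρ)
    · by_cases hd : ∀ x, ¬ Dangerous R.program (R.rule r) x
      · exact Or.inl hd
      right
      have hone : ∀ x, Dangerous R.program (R.rule r) x →
          ∃ W ∈ R.ward r, ∃ i, W.args i = .var x := by
        intro x hx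
        obtain ⟨b, hb, hbx⟩ := hx.1.1
        rcases mem_rule_body.1 hb with ⟨a, ha, rfl⟩ | rfl
        · exact ⟨a, ha, hbx⟩
        · exact absurd hx.1 (hQ r x hbx)
      have hlen := (R.isWardList r hr).length_le
      push Not at hd
      obtain ⟨x, hx⟩ := hd
      obtain ⟨W, hW, -⟩ := hone x hx
      have huniq : ∀ a ∈ R.ward r, a = W := fun a ha => by
        match hl : R.ward r, hlen with
        | [], _ => rw [hl] at ha; cases ha
        | [b], _ =>
          rw [hl, List.mem_singleton] at ha hW
          rw [ha, hW]
      refine ⟨.rel (W.lift R.ar), mem_rule_body.2 (Or.inl ⟨W, hW, rfl⟩), fun y hy => ?_, ?_⟩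
      · obtain ⟨W', hW', hy⟩ := hone y hy
        rw [huniq W' hW'] at hy
        exact hy
      · intro B hB hne y _ hy
        rcases mem_rule_body.1 hB with ⟨a, ha, rfl⟩ | rfl
        · exact absurd (by rw [huniq a ha]) hne
        · exact hQ r y hy
    · exact Or.inl fun x hx => not_harmful_of_mem_auxRules hρ x hx.1
  · rintro ρ (⟨r, hr, rfl⟩ | hρ) ⟨A, hA, B, hB, hne, x, hxA, hxB, hx⟩
    · rcases mem_rule_body.1 hA with ⟨a, ha, rfl⟩ | rfl
      · rcases mem_rule_body.1 hB with ⟨b, hb, rfl⟩ | rfl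
        · have hlen := (R.isWardList r hr).length_le
          refine hne ?_
          match hl : R.ward r, hlen with
          | [], _ => rw [hl] at ha; cases ha
          | [c], _ =>
            rw [hl, List.mem_singleton] at ha hb
            rw [ha, hb]
        · exact hQ r x hxB hx
      · exact hQ r x hxA hx
    · exact not_harmful_of_mem_auxRules hρ x hx

end Rewriting

end Rewriting

/-! ### The rewritten program is sound -/

section Soundness

variable {S : Schema.{u}} {C : Type v} {P : Set (Rule S C)} {R : Rewriting P}

/-- All nulls within the value are invented by rules of `P`. -/
def Val.Over (P : Set (Rule S C)) : Val S C → Prop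
  | .const _ => True
  | .null r _ σ => r ∈ P ∧ ∀ y, (σ y).Over P

theorem Rule.over_extend {r : Rule S C} (hr : r ∈ P) {θ : ℕ → Val S C}
    (hθ : ∀ x, r.InBody x → (θ x).Over P) (x : ℕ) : (r.extend θ x).Over P := by
  by_cases hb : r.InBody x
  · rw [Rule.extend_of_inBody hb]
    exact hθ x hb
  · rw [Rule.extend_of_not_inBody hb]
    exact ⟨hr, fun y => hθ y.1 y.2.1⟩

theorem Chase.over {D : Set (Atom S C)} {F : Atom S (Val S C)} (h : Chase P D F) :
    ∀ i, (F.args i).Over P := by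
  induction h with
  | database F hF => exact fun i => trivial
  | step r hr θ hrel hdom a ha ih =>
    intro i
    rcases hx : a.args i with c | x
    · simp [Atom.map, hx, Term.eval, Val.Over]
    · simp only [Atom.map, hx, Term.eval]
      refine r.over_extend hr (fun y hy => ?_) x
      obtain ⟨b, hb, hby⟩ := hy
      cases b with
      | dom t =>
        obtain ⟨c, -, hc⟩ := hdom t hb
        have ht : t = .var y := hby
        rw [ht, Term.eval] at hc
        rw [hc]
        trivial
      | rel b =>
        obtain ⟨j, hj⟩ := hby
        simpa [Atom.map, hj, Term.eval] using ih b hb j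

namespace Rewriting

theorem tr_null_of_mem {r : Rule S C} (z : ℕ) (σ : {x : ℕ // r.Frontier x} → Val S C) :
    R.tr (.null r z σ) = .null (R.rule r) z
      (open Classical in fun y => if h : r.Frontier y.1 then R.tr (σ ⟨y.1, h⟩) else default) := rfl

theorem tr_eq_const {v : Val S C} {c : C} : R.tr v = .const c ↔ v = .const c := by
  cases v <;> simp [tr]

/-- The auxiliary atom in the body of a rewritten rule tells which rule has been rewritten. -/
theorem rule_injOn : Set.InjOn R.rule P := by
  intro r hr r' hr' h
  have h1 := congrArg (fun ρ : Rule R.schema C => ρ.body.getLast?) h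
  simp only [rule, List.getLast?_append, List.getLast?_singleton, Option.some_or, Option.some_inj]
    at h1
  have h2 := congrArg Atom.rel (BodyAtom.rel.inj h1)
  have h3 : R.sym r = R.sym r' := Sum.inr.inj h2
  have h4 := R.query_sym r hr
  rw [h3, R.query_sym r' hr'] at h4
  exact (Query.body.inj h4).symm

/-- The translation is injective on the values whose nulls are invented by rules of `P`. -/
theorem tr_injOn : ∀ {v w : Val S C}, v.Over P → w.Over P → R.tr v = R.tr w → v = w := by
  intro v
  induction v with
  | const c =>
    intro w _ _ h
    exact (tr_eq_const.1 h.symm).symm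
  | null r z σ ih =>
    intro w hv hw h
    cases w with
    | const c => exact tr_eq_const.1 h
    | null r' z' σ' =>
      rw [tr_null_of_mem, tr_null_of_mem] at h
      obtain ⟨h1, rfl, h2⟩ := Val.null.inj h
      obtain rfl := rule_injOn hv.1 hw.1 h1
      congr 1
      funext y
      refine ih y (hv.2 y) (hw.2 y) ?_
      have := congrFun (eq_of_heq h2) ⟨y.1, (rule_frontier hv.1).2 y.2⟩
      simpa [y.2] using this

/-- Firing a rule of `P` and firing its rewriting produce corresponding facts. -/
theorem extend_tr {r : Rule S C} (hr : r ∈ P) {θ : ℕ → Val S C} {θ' : ℕ → Val R.schema C}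
    (h : ∀ x, r.Frontier x → θ' x = R.tr (θ x)) {x : ℕ} (hx : r.InHead x) :
    (R.rule r).extend θ' x = R.tr (r.extend θ x) := by
  by_cases hb : r.InBody x
  · rw [Rule.extend_of_inBody hb, Rule.extend_of_inBody (rule_inBody_of_frontier hr ⟨hb, hx⟩),
      h x ⟨hb, hx⟩]
  · rw [Rule.extend_of_not_inBody hb,
      Rule.extend_of_not_inBody fun hc => hb (inBody_of_rule_inBody hr hc), tr_null_of_mem]
    congr 1
    funext y
    have hy : r.Frontier y.1 := (rule_frontier hr).1 y.2
    simp [hy, h y.1 hy]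

theorem map_extend_tr {r : Rule S C} (hr : r ∈ P) {θ : ℕ → Val S C} {θ' : ℕ → Val R.schema C}
    (h : ∀ x, r.Frontier x → θ' x = R.tr (θ x)) {a : Atom S (Term C)} (ha : a ∈ r.head) :
    a.map (Term.eval ((R.rule r).extend θ')) = (a.map (Term.eval (r.extend θ))).map R.tr := by
  refine Atom.map_congr (g := fun t => R.tr (Term.eval (r.extend θ) t)) fun i => ?_
  rcases hx : a.args i with c | x
  · rfl
  · exact extend_tr hr h ⟨a, ha, i, hx⟩

theorem mean_lift {D : Set (Atom S C)} {A : Atom S (Val R.schema C)} :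
    R.Mean D (A.lift R.ar) ↔ ∃ F, Chase P D F ∧ A = F.map R.tr := by
  constructor
  · rintro ⟨u, hu, h⟩
    exact ⟨_, hu, Atom.mk_congr h⟩
  · rintro ⟨F, hF, rfl⟩
    exact ⟨F.args, hF, fun i => rfl⟩

theorem mean_lift_const {D : Set (Atom S C)} {A : Atom S C} :
    R.Mean D ((A.map Val.const).lift R.ar) ↔ Chase P D (A.map .const) := by
  rw [mean_lift]
  constructor
  · rintro ⟨⟨T, u⟩, hF, h⟩
    obtain ⟨T', c⟩ := A
    simp only [Atom.map, Atom.mk.injEq] at h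
    obtain ⟨rfl, h⟩ := h
    convert hF using 1
    refine Atom.mk_congr fun i => ?_
    exact (tr_eq_const.1 (congrFun (eq_of_heq h) i).symm).symm
  · exact fun h => ⟨_, h, rfl⟩

theorem mean_aux {D : Set (Atom S C)} {j : Fin R.k} {c : Fin (R.ar j) → C} :
    R.Mean D ((R.auxAtom j c).map Val.const) ↔ (R.query j).Holds P D c := by
  constructor
  · rintro ⟨c', h, hc⟩
    obtain rfl : c = c' := funext fun i => Val.const.inj (h i)
    exact hc
  · exact fun h => ⟨c, fun i => rfl, h⟩

theorem ar_sym {r : Rule S C} (hr : r ∈ P) : R.ar (R.sym r) = (harmlessVars P r).length := by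
  rw [ar, R.query_sym r hr, Query.arity]

theorem activeDomain_lift (D : Set (Atom S C)) :
    activeDomain (Atom.lift R.ar '' D) = activeDomain D := by
  ext c
  constructor
  · rintro ⟨_, ⟨F, hF, rfl⟩, i, hi⟩
    exact ⟨F, hF, i, hi⟩
  · rintro ⟨F, hF, i, hi⟩
    exact ⟨_, ⟨F, hF, rfl⟩, i, hi⟩

/-- The rewritten rules are correct for the intended meaning. -/
theorem mean_of_rule {D : Set (Atom S C)} {r : Rule S C} (hr : r ∈ P) {θ : ℕ → Val R.schema C}
    (h : ∀ b : Atom R.schema (Term C), .rel b ∈ (R.rule r).body →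
      R.Mean D (b.map (Term.eval θ))) {a : Atom S (Term C)} (ha : a ∈ r.head) :
    R.Mean D ((a.lift R.ar).map (Term.eval ((R.rule r).extend θ))) := by
  have hW := R.isWardList r hr
  obtain ⟨c, hc, hQ⟩ := h _ (mem_rule_body.2 (Or.inr rfl))
  rw [R.query_sym r hr] at hQ
  obtain ⟨θ₂, hθ₂, hbody⟩ := hQ
  have hharm : ∀ x ∈ harmlessVars P r, ∃ d, θ x = .const d ∧ θ₂ x = .const d := by
    intro x hx
    obtain ⟨i, hi, rfl⟩ := List.mem_iff_getElem.1 hx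
    have hi' : i < R.ar (R.sym r) := by rwa [ar_sym hr]
    refine ⟨c ⟨i, hi'⟩, ?_, hθ₂ ⟨i, hi'⟩ _ (List.getElem?_eq_getElem hi)⟩
    have := hc ⟨i, hi'⟩
    refine Eq.trans ?_ this
    change θ _ = θ ((harmlessVars P r).getD i 0)
    rw [List.getD_eq_getElem _ _ hi]
  -- Every ward atom is matched by the translation of a fact of the chase of `P`.
  have hward : ∀ b ∈ R.ward r, ∃ F, Chase P D F ∧ b.map (Term.eval θ) = F.map R.tr := fun b hb =>
    mean_lift.1 (h _ (mem_rule_body.2 (Or.inl ⟨b, hb, rfl⟩)))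
  have hpre : ∀ x, (∃ b ∈ R.ward r, ∃ i, b.args i = .var x) →
      ∃ v : Val S C, v.Over P ∧ R.tr v = θ x := by
    rintro x ⟨b, hb, i, hi⟩
    obtain ⟨⟨T, u⟩, hF, hbF⟩ := hward b hb
    obtain ⟨T', t⟩ := b
    simp only [Atom.map, Atom.mk.injEq] at hbF
    obtain ⟨rfl, hbF⟩ := hbF
    refine ⟨u i, hF.over i, ?_⟩
    have := congrFun (eq_of_heq hbF) i
    rw [show t i = .var x from hi] at this
    exact this.symm
  classical
  let θ₁ : ℕ → Val S C := fun x =>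
    if hx : ∃ b ∈ R.ward r, ∃ i, b.args i = .var x then (hpre x hx).choose else default
  have hθ₁ : ∀ x, (∃ b ∈ R.ward r, ∃ i, b.args i = .var x) →
      (θ₁ x).Over P ∧ R.tr (θ₁ x) = θ x := by
    intro x hx
    simp only [θ₁, dif_pos hx]
    exact (hpre x hx).choose_spec
  have hsat : r.BodyHolds (chase P D) D (glue (R.ward r) θ₁ θ₂) := by
    refine hW.bodyHolds_glue (fun b hb => ?_) hbody ?_
    · obtain ⟨⟨T, u⟩, hF, hbF⟩ := hward b hb
      obtain ⟨T', t⟩ := b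
      simp only [Atom.map, Atom.mk.injEq] at hbF
      obtain ⟨rfl, hbF⟩ := hbF
      refine Eq.mp (congrArg (Chase P D) (Atom.mk_congr fun i => Eq.symm ?_)) hF
      change Term.eval θ₁ (t i) = u i
      have hi := congrFun (eq_of_heq hbF) i
      rcases hx : t i with d | x
      · rw [hx] at hi
        exact (tr_eq_const.1 hi.symm).symm
      · rw [hx] at hi
        obtain ⟨h1, h2⟩ := hθ₁ x ⟨_, hb, i, hx⟩
        exact tr_injOn h1 (hF.over i) (h2.trans hi)
    · rintro x hx hh
      obtain ⟨b, hb, i, hi⟩ := hx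
      obtain ⟨d, h1, h2⟩ := hharm x (mem_harmlessVars.2 ⟨hW.inBody hb hi, hh⟩)
      rw [h2, ← tr_eq_const (R := R), (hθ₁ x ⟨b, hb, i, hi⟩).2, h1]
  have hfr : ∀ x, r.Frontier x → θ x = R.tr (glue (R.ward r) θ₁ θ₂ x) := by
    intro x hx
    by_cases hxW : ∃ b ∈ R.ward r, ∃ i, b.args i = .var x
    · rw [glue_of_mem hxW, (hθ₁ x hxW).2]
    · obtain ⟨d, h1, h2⟩ := hharm x
        (mem_harmlessVars.2 ⟨hx.1, hW.not_harmful_of_frontier hx hxW⟩)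
      rw [glue_of_not_mem hxW, h1, h2]
      rfl
  exact mean_lift.2 ⟨_, chase_of_bodyHolds hr hsat ⟨a, ha, rfl⟩, map_extend_tr hr hfr ha⟩

/-- Everything that the rewritten program derives has its intended meaning. -/
theorem mean_of_chase {D : Set (Atom S C)} {A : Atom R.schema (Val R.schema C)}
    (h : Chase R.program (Atom.lift R.ar '' D) A) : R.Mean D A := by
  induction h with
  | database F hF =>
    obtain ⟨F, hF, rfl⟩ := hF
    exact mean_lift_const.2 (Chase.database F hF)
  | step ρ hρ θ hrel hdom a ha ih =>
    rcases hρ with ⟨r, hr, rfl⟩ | ⟨s, a', rfl, -, -, -, hsafe, hsound⟩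
    · obtain ⟨a, ha', rfl⟩ := List.mem_map.1 ha
      exact mean_of_rule hr ih ha'
    · rw [List.mem_singleton] at ha
      subst ha
      -- The rule has no existential variables.
      convert hsound D θ (fun b hb => ih b (by simpa using hb)) (fun t ht => ?_) using 1
      · refine Atom.map_congr fun i => ?_
        rcases hx : a.args i with c | x
        · rfl
        · obtain ⟨b, hb, hbx, -⟩ := hsafe x (Or.inr ⟨i, hx⟩)
          exact Rule.extend_of_inBody ⟨b, by simpa using hb, hbx⟩
      · simpa only [activeDomain_lift] using hdom t (by simpa using ht)

/-- The rewriting is correct as soon as its auxiliary rules derive all matches of bodies of rules of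
`P`, projected to the harmless variables. -/
theorem chase_tr {D : Set (Atom S C)}
    (hQ : ∀ r ∈ P, ∀ θ : ℕ → Val S C, r.BodyHolds (chase P D) D θ →
      ∀ c : Fin (R.ar (R.sym r)) → C,
      (∀ i x, (harmlessVars P r)[i.1]? = some x → θ x = .const (c i)) →
      Chase R.program (Atom.lift R.ar '' D) ((R.auxAtom (R.sym r) c).map .const))
    {F : Atom S (Val S C)} (h : Chase P D F) :
    Chase R.program (Atom.lift R.ar '' D) ((F.map R.tr).lift R.ar) := by
  induction h with
  | database F hF => exact Chase.database (F.lift R.ar) ⟨F, hF, rfl⟩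
  | step r hr θ hrel hdom a ha ih =>
    have key : Chase R.program (Atom.lift R.ar '' D)
        ((a.lift R.ar).map (Term.eval ((R.rule r).extend fun x => R.tr (θ x)))) := by
      refine Chase.step (R.rule r) (Or.inl ⟨r, hr, rfl⟩) _ (fun b hb => ?_) (fun t ht => ?_) _
        (List.mem_map.2 ⟨a, ha, rfl⟩)
      · rcases mem_rule_body.1 hb with ⟨b, hbW, hbe⟩ | hbe
        · cases hbe
          convert ih b ((R.isWardList r hr).mem_body b hbW) using 1
          refine congrArg (Atom.lift R.ar) (Atom.map_congr (a := b)
            (f := Term.eval fun x => R.tr (θ x)) (g := fun t => R.tr (Term.eval θ t)) fun i => ?_)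
          cases b.args i <;> rfl
        · cases hbe
          have hc : ∀ i : Fin (R.ar (R.sym r)), ∃ c : C,
              θ ((harmlessVars P r).getD i.1 0) = .const c := by
            intro i
            have hi : i.1 < (harmlessVars P r).length := (ar_sym (R := R) hr) ▸ i.2
            rw [List.getD_eq_getElem _ _ hi]
            have := mem_harmlessVars.1 (List.getElem_mem hi)
            exact const_of_not_harmful ⟨hrel, hdom⟩ this.1 this.2
          choose c hc using hc
          convert hQ r hr θ ⟨hrel, hdom⟩ c (fun i x hx => ?_) using 1
          · refine Atom.mk_congr fun i => ?_
            exact congrArg R.tr (hc i)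
          · rw [← hc i, List.getD_eq_getElem?_getD, hx, Option.getD_some]
      · rcases mem_rule_body.1 ht with ⟨b, hb, hbe⟩ | hbe <;> cases hbe
    exact (congrArg (fun A => Chase R.program _ (Atom.lift R.ar A))
      (map_extend_tr hr (fun x _ => rfl) ha)).mp key

end Rewriting

end Soundness

/-! ### The auxiliary rules are complete -/

section Completeness

variable {S : Schema.{u}} {C : Type v} {P : Set (Rule S C)} {R : Rewriting P}

namespace Rewriting

/-- A ground derivation step is an instance of an auxiliary rule if the step stays correct for the
intended meaning over every database `D'` under every renaming `γ` of constants that fixes the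
constants of rules and maps constants of `D` to constants of `D'`.  The rule is obtained from the
step by replacing constants by variables, with a `Dom` atom for each constant of `D`. -/
theorem chase_of_entails {D : Set (Atom S C)} (Ψ : Finset (Atom R.schema C))
    (κ : Atom R.schema C) (hκ : κ.rel.isRight) (L : List C) (hL : L.length ≤ R.maxVars)
    (hrel : ∀ a ∈ Ψ, a.rel ∈ Sum.inl '' R.rels ∪ Set.range Sum.inr)
    (hocc : ∀ a, a ∈ Ψ ∨ a = κ → ∀ i, a.args i ∈ L)
    (hsafe : ∀ a, a ∈ Ψ ∨ a = κ → ∀ i, a.args i ∈ R.consts ∨ a.args i ∈ activeDomain D ∨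
      ∃ a' ∈ Ψ, a'.rel.isRight ∧ ∃ i', a'.args i' = a.args i)
    (hent : ∀ D' (γ : C → C), (∀ c ∈ R.consts, γ c = c) →
      (∀ c ∈ L, c ∈ activeDomain D → γ c ∈ activeDomain D') →
      (∀ a ∈ Ψ, R.Mean D' ((a.map γ).map .const)) → R.Mean D' ((κ.map γ).map .const))
    (hΨ : ∀ a ∈ Ψ, Chase R.program (Atom.lift R.ar '' D) (a.map .const)) :
    Chase R.program (Atom.lift R.ar '' D) (κ.map .const) := by
  classical
  let T : C → Term C := fun c => if c ∈ R.consts then .const c else .var (L.idxOf c)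
  have hTterms : ∀ c ∈ L, T c ∈ R.terms := by
    intro c hc
    by_cases h : c ∈ R.consts
    · simp only [T, if_pos h]
      exact Or.inl ⟨c, h, rfl⟩
    · simp only [T, if_neg h]
      exact Or.inr ⟨_, (List.idxOf_lt_length_iff.2 hc).trans_le hL, rfl⟩
  have hTvar : ∀ c ∈ L, ∀ c' ∈ L, ∀ x, T c = .var x → T c' = .var x → c = c' := by
    intro c hc c' hc' x h h'
    by_cases h1 : c ∈ R.consts
    · simp [T, if_pos h1] at h
    by_cases h2 : c' ∈ R.consts
    · simp [T, if_pos h2] at h'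
    simp only [T, if_neg h1, Term.var.injEq] at h
    simp only [T, if_neg h2, Term.var.injEq] at h'
    exact (List.idxOf_inj hc).1 (h.trans h'.symm)
  let s : Finset (BodyAtom R.schema C) := Ψ.image (fun a => .rel (a.map T)) ∪
    (L.toFinset.filter (· ∈ activeDomain D)).image fun c => .dom (T c)
  have hs : ∀ b, b ∈ s ↔ (∃ a ∈ Ψ, BodyAtom.rel (a.map T) = b) ∨
      ∃ c, (c ∈ L ∧ c ∈ activeDomain D) ∧ BodyAtom.dom (T c) = b := by
    intro b
    simp [s]
  have hsafe' : ∀ a, a ∈ Ψ ∨ a = κ → ∀ i x, T (a.args i) = .var x →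
      ∃ b ∈ s, b.HasVar x ∧ ∀ a' : Atom R.schema (Term C), b = .rel a' → a'.rel.isRight := by
    intro a ha i x hx
    rcases hsafe a ha i with h | h | ⟨a', ha', hr, i', h⟩
    · simp [T, if_pos h] at hx
    · exact ⟨_, (hs _).2 (Or.inr ⟨_, ⟨hocc a ha i, h⟩, rfl⟩), hx, fun a' h' => by cases h'⟩
    · refine ⟨_, (hs _).2 (Or.inl ⟨a', ha', rfl⟩), ⟨i', ?_⟩, ?_⟩
      · exact (congrArg T h).trans hx
      · intro a'' h''
        cases h''
        exact hr
  have hmem : (⟨s.toList, [κ.map T]⟩ : Rule R.schema C) ∈ R.auxRules := by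
    refine ⟨s, κ.map T, rfl, ?_, ⟨?_, fun i => hTterms _ (hocc κ (Or.inr rfl) i)⟩, hκ, ?_, ?_⟩
    · intro b hb
      rcases (hs b).1 hb with ⟨a, ha, rfl⟩ | ⟨c, hc, rfl⟩
      · exact Or.inl ⟨_, ⟨hrel a ha, fun i => hTterms _ (hocc a (Or.inl ha) i)⟩, rfl⟩
      · exact Or.inr ⟨_, hTterms c hc.1, rfl⟩
    · obtain ⟨j, hj⟩ := Sum.isRight_iff.1 hκ
      exact Or.inr ⟨j, hj.symm⟩
    · rintro x (⟨b, hb, hx⟩ | ⟨i, hx⟩)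
      · rcases (hs b).1 hb with ⟨a, ha, rfl⟩ | ⟨c, hc, rfl⟩
        · obtain ⟨i, hi⟩ := hx
          exact hsafe' a (Or.inl ha) i x hi
        · exact ⟨_, hb, hx, fun a' h' => by cases h'⟩
      · exact hsafe' κ (Or.inr rfl) i x hx
    · intro D' θ hb hd
      let γ : C → C := fun c => ((T c).eval θ).const?.getD c
      have hγ : ∀ c d, (T c).eval θ = .const d → (T c).eval θ = .const (γ c) := by
        intro c d h
        simp [γ, h, Val.const?]
      have hγc : ∀ c ∈ R.consts, (T c).eval θ = .const (γ c) := by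
        intro c hc
        refine hγ c c ?_
        simp only [T, if_pos hc, Term.eval]
      have hγΨ : ∀ a, a ∈ Ψ ∨ a = κ → ∀ i, (T (a.args i)).eval θ = .const (γ (a.args i)) := by
        intro a ha i
        rcases hsafe a ha i with h | h | ⟨⟨T', t⟩, ha', hr, i', h⟩
        · exact hγc _ h
        · obtain ⟨d, -, hd⟩ := hd _ ((hs _).2 (Or.inr ⟨_, ⟨hocc a ha i, h⟩, rfl⟩))
          exact hγ _ d hd
        · have hm := hb _ ((hs _).2 (Or.inl ⟨_, ha', rfl⟩))
          cases T' with
          | inl T' => simp at hr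
          | inr j =>
            obtain ⟨c, hc, -⟩ := hm
            refine hγ _ (c i') ?_
            rw [← h]
            exact hc i'
      have hmap : ∀ a, a ∈ Ψ ∨ a = κ → (a.map T).map (Term.eval θ) = (a.map γ).map .const :=
        fun a ha => Atom.map_congr (f := fun c => (T c).eval θ) (g := fun c => .const (γ c))
          fun i => hγΨ a ha i
      rw [hmap κ (Or.inr rfl)]
      refine hent D' γ (fun c hc => ?_) (fun c hc hcD => ?_) fun a ha => ?_
      · have := hγc c hc
        simp only [T, if_pos hc, Term.eval, Val.const.injEq] at this
        exact this.symm
      · obtain ⟨d, hdD, hd⟩ := hd _ ((hs _).2 (Or.inr ⟨c, ⟨hc, hcD⟩, rfl⟩))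
        have := (hγ _ d hd).symm.trans hd
        rw [Val.const.inj this]
        exact hdD
      · rw [← hmap a (Or.inl ha)]
        exact hb _ ((hs _).2 (Or.inl ⟨a, ha, rfl⟩))
  let θ : ℕ → Val R.schema C := fun n => (L[n]?).elim default .const
  have hθ : ∀ c ∈ L, (T c).eval θ = .const c := by
    intro c hc
    by_cases h : c ∈ R.consts
    · simp only [T, if_pos h, Term.eval]
    · simp only [T, if_neg h, Term.eval, θ, List.getElem?_idxOf hc, Option.elim]
  have hθmap : ∀ a, a ∈ Ψ ∨ a = κ → (a.map T).map (Term.eval θ) = a.map .const := fun a ha =>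
    Atom.map_congr (f := fun c => (T c).eval θ) fun i => hθ _ (hocc a ha i)
  have hstep := Chase.step (P := R.program) (D := Atom.lift R.ar '' D) _ (Or.inr hmem) θ
    (fun b hb => ?_) (fun t ht => ?_) (κ.map T) (by simp)
  · convert hstep using 1
    rw [← hθmap κ (Or.inr rfl)]
    refine Atom.map_congr fun i => ?_
    rcases hx : (κ.map T).args i with c | x
    · rfl
    · obtain ⟨b, hb, hbx, -⟩ := hsafe' κ (Or.inr rfl) i x hx
      exact (Rule.extend_of_inBody (r := ⟨s.toList, [κ.map T]⟩) (θ := θ)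
        ⟨b, by simpa using hb, hbx⟩).symm
  · rcases (hs _).1 (by simpa using hb) with ⟨a, ha, h⟩ | ⟨c, hc, h⟩
    · cases h
      rw [hθmap a (Or.inl ha)]
      exact hΨ a ha
    · cases h
  · rcases (hs _).1 (by simpa using ht) with ⟨a, ha, h⟩ | ⟨c, hc, h⟩
    · cases h
    · cases h
      exact ⟨c, by rw [activeDomain_lift]; exact hc.2, hθ c hc.1⟩

/-- The auxiliary facts for the pattern of `Φ`, at the constants of `Φ`, are derivable. -/
def Derives (R : Rewriting P) (D : Set (Atom S C)) (Φ : Finset (Atom S (Val S C))) : Prop :=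
  ∀ j, R.query j = patternOf Φ → ∀ c : Fin (R.ar j) → C,
    (∀ i, (factConsts Φ)[i.1]? = some (c i)) →
    Chase R.program (Atom.lift R.ar '' D) ((R.auxAtom j c).map .const)

/-- A set of facts that is small enough to have an auxiliary symbol for its pattern. -/
def Small (R : Rewriting P) (Φ : Finset (Atom S (Val S C))) : Prop :=
  Φ.card ≤ R.maxFacts ∧ ∀ F ∈ Φ, F.rel ∈ R.rels

theorem ar_of_query {Φ : Finset (Atom S (Val S C))} {j : Fin R.k} (hj : R.query j = patternOf Φ) :
    R.ar j = (factConsts Φ).length := by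
  rw [ar, hj]
  rfl

theorem exists_args {Φ : Finset (Atom S (Val S C))} {j : Fin R.k} (hj : R.query j = patternOf Φ) :
    ∃ c : Fin (R.ar j) → C, ∀ i, (factConsts Φ)[i.1]? = some (c i) :=
  ⟨fun i => (factConsts Φ)[i.1]'(ar_of_query hj ▸ i.2), fun _ => List.getElem?_eq_getElem _⟩

theorem mem_factConsts_iff_args {Φ : Finset (Atom S (Val S C))} {j : Fin R.k}
    (hj : R.query j = patternOf Φ) {c : Fin (R.ar j) → C}
    (hc : ∀ i, (factConsts Φ)[i.1]? = some (c i)) {d : C} : d ∈ factConsts Φ ↔ ∃ i, c i = d := by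
  constructor
  · intro hd
    obtain ⟨i, hi, rfl⟩ := List.mem_iff_getElem.1 hd
    refine ⟨⟨i, ar_of_query hj ▸ hi⟩, ?_⟩
    have := hc ⟨i, ar_of_query hj ▸ hi⟩
    rw [List.getElem?_eq_getElem hi] at this
    exact (Option.some.inj this).symm
  · rintro ⟨i, rfl⟩
    exact List.mem_of_getElem? (hc i)

theorem mean_pattern {D : Set (Atom S C)} {Φ : Finset (Atom S (Val S C))} {j : Fin R.k}
    (hj : R.query j = patternOf Φ) {c : Fin (R.ar j) → C}
    (hc : ∀ i, (factConsts Φ)[i.1]? = some (c i)) (γ : C → C) :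
    R.Mean D (((R.auxAtom j c).map γ).map Val.const) ↔ ∃ f : Val S C → Val S C,
      (∀ c, f (.const c) = .const (γ c)) ∧ ∀ F ∈ Φ, F.map f ∈ chase P D := by
  rw [← patternOf_holds_iff hc (ar_of_query hj) γ, ← hj]
  exact mean_aux

theorem length_factConsts_le_maxVals {Φ : Finset (Atom S (Val S C))} (hΦ : R.Small Φ) :
    (factConsts Φ).length ≤ R.maxVals :=
  (length_factConsts_le Φ).trans (R.length_vals_le Φ hΦ.1 hΦ.2)

theorem derives_empty (D : Set (Atom S C)) : R.Derives D ∅ := by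
  intro j hj c hc
  have h0 : ∀ i : Fin (R.ar j), False := fun i => by
    have := (mem_factConsts_iff_args hj hc).2 ⟨i, rfl⟩
    simp [mem_factConsts] at this
  refine chase_of_entails ∅ _ rfl [] (by simp) (by simp) ?_ ?_ ?_ (by simp)
  · rintro a (ha | rfl) i
    · simp at ha
    · exact (h0 i).elim
  · rintro a (ha | rfl) i
    · simp at ha
    · exact (h0 i).elim
  · intro D' γ _ _ _
    refine (mean_pattern hj hc γ).2 ⟨fun v => (v.const?).elim v fun c => .const (γ c),
      fun c => rfl, by simp⟩

open Classical in
theorem derives_insert_database {D : Set (Atom S C)} {Φ : Finset (Atom S (Val S C))}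
    {F : Atom S C} (hF : F ∈ D) (hsmall : R.Small (insert (F.map .const) Φ))
    (hΦ : R.Derives D Φ) : R.Derives D (insert (F.map .const) Φ) := by
  intro j hj c hc
  have hsmall' : R.Small Φ := ⟨(Finset.card_le_card (Finset.subset_insert _ _)).trans hsmall.1,
    fun G hG => hsmall.2 G (Finset.mem_insert_of_mem hG)⟩
  obtain ⟨j', hj'⟩ := R.exists_query_pattern Φ hsmall'.1 hsmall'.2
  obtain ⟨c', hc'⟩ := exists_args hj'
  have hsub : ∀ d ∈ factConsts Φ, d ∈ factConsts (insert (F.map .const) Φ) := by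
    intro d hd
    obtain ⟨G, hG, hd⟩ := mem_factConsts.1 hd
    exact mem_factConsts.2 ⟨G, Finset.mem_insert_of_mem hG, hd⟩
  have hFL : ∀ i, F.args i ∈ factConsts (insert (F.map .const) Φ) := fun i =>
    mem_factConsts.2 ⟨_, Finset.mem_insert_self _ _, i, rfl⟩
  refine chase_of_entails {R.auxAtom j' c', F.lift R.ar} _ rfl
    (factConsts (insert (F.map .const) Φ))
    ((length_factConsts_le_maxVals hsmall).trans R.maxVals_le) ?_ ?_ ?_ ?_ ?_
  · intro a ha
    rcases Finset.mem_insert.1 ha with rfl | ha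
    · exact Or.inr ⟨j', rfl⟩
    · obtain rfl := Finset.mem_singleton.1 ha
      exact Or.inl ⟨_, hsmall.2 _ (Finset.mem_insert_self _ _), rfl⟩
  · rintro a (ha | rfl) i
    · rcases Finset.mem_insert.1 ha with rfl | ha
      · exact hsub _ ((mem_factConsts_iff_args hj' hc').2 ⟨i, rfl⟩)
      · obtain rfl := Finset.mem_singleton.1 ha
        exact hFL i
    · exact (mem_factConsts_iff_args hj hc).2 ⟨i, rfl⟩
  · rintro a (ha | rfl) i
    · rcases Finset.mem_insert.1 ha with rfl | ha
      · exact Or.inr (Or.inr ⟨_, Finset.mem_insert_self _ _, rfl, i, rfl⟩)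
      · obtain rfl := Finset.mem_singleton.1 ha
        exact Or.inr (Or.inl ⟨F, hF, i, rfl⟩)
    · have hi := (mem_factConsts_iff_args hj hc).2 ⟨i, rfl⟩
      obtain ⟨G, hG, l, hl⟩ := mem_factConsts.1 hi
      rcases Finset.mem_insert.1 hG with rfl | hG
      · exact Or.inr (Or.inl ⟨F, hF, l, Val.const.inj hl⟩)
      · obtain ⟨i', hi'⟩ := (mem_factConsts_iff_args hj' hc').1 (mem_factConsts.2 ⟨G, hG, l, hl⟩)
        exact Or.inr (Or.inr ⟨_, Finset.mem_insert_self _ _, rfl, i', hi'⟩)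
  · intro D' γ _ _ hmean
    obtain ⟨f, hf, hfΦ⟩ := (mean_pattern hj' hc' γ).1 (hmean _ (Finset.mem_insert_self _ _))
    refine (mean_pattern hj hc γ).2 ⟨f, hf, fun G hG => ?_⟩
    rcases Finset.mem_insert.1 hG with rfl | hG
    · have h := (mean_lift_const (A := F.map γ)).1 (hmean (F.lift R.ar) (by simp))
      have hFγ : (F.map .const).map f = (F.map γ).map .const :=
        Atom.map_congr (f := fun c => f (.const c)) (g := fun c => .const (γ c))
          fun i => hf (F.args i)
      rw [hFγ]
      exact h
    · exact hfΦ G hG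
  · intro a ha
    rcases Finset.mem_insert.1 ha with rfl | ha
    · exact hΦ j' hj' c' hc'
    · obtain rfl := Finset.mem_singleton.1 ha
      exact Chase.database (F.lift R.ar) ⟨F, hF, rfl⟩

open Classical in
/-- The facts to which a valuation maps the relational atoms of the body of a rule. -/
noncomputable def bodyFacts (r : Rule S C) (θ : ℕ → Val S C) : Finset (Atom S (Val S C)) :=
  (r.body.filterMap fun b => match b with
    | .rel a => some (a.map (Term.eval θ))
    | .dom _ => none).toFinset

theorem mem_bodyFacts {r : Rule S C} {θ : ℕ → Val S C} {F : Atom S (Val S C)} :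
    F ∈ bodyFacts r θ ↔ ∃ a : Atom S (Term C), .rel a ∈ r.body ∧ F = a.map (Term.eval θ) := by
  classical
  simp only [bodyFacts, List.mem_toFinset, List.mem_filterMap]
  constructor
  · rintro ⟨b, hb, h⟩
    cases b with
    | rel a => exact ⟨a, hb, (Option.some.inj h).symm⟩
    | dom t => cases h
  · rintro ⟨a, ha, rfl⟩
    exact ⟨_, ha, rfl⟩

theorem small_bodyFacts {r : Rule S C} (hr : r ∈ P) (θ : ℕ → Val S C) :
    R.Small (bodyFacts r θ) := by
  classical
  constructor
  · exact (List.toFinset_card_le _).trans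
      ((List.length_filterMap_le _ _).trans (R.length_body_le r hr))
  · intro F hF
    obtain ⟨a, ha, rfl⟩ := mem_bodyFacts.1 hF
    exact R.rel_mem r hr a ha

/-- The auxiliary atom of `r` follows from the pattern of the body facts; the `Dom` atoms of the body
are checked by the `Dom` atoms that every auxiliary rule may have. -/
theorem derives_body {D : Set (Atom S C)} {r : Rule S C} (hr : r ∈ P) {θ : ℕ → Val S C}
    (hθ : r.BodyHolds (chase P D) D θ) (hd : R.Derives D (bodyFacts r θ))
    {c : Fin (R.ar (R.sym r)) → C}
    (hc : ∀ i x, (harmlessVars P r)[i.1]? = some x → θ x = .const (c i)) :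
    Chase R.program (Atom.lift R.ar '' D) ((R.auxAtom (R.sym r) c).map .const) := by
  classical
  have hsmall := small_bodyFacts (R := R) hr θ
  obtain ⟨j, hj⟩ := R.exists_query_pattern _ hsmall.1 hsmall.2
  obtain ⟨c', hc'⟩ := exists_args hj
  let doms : List C := r.body.filterMap fun b => match b with
    | .rel _ => none
    | .dom t => (t.eval θ).const?
  have hdoms : ∀ t, .dom t ∈ r.body → ∀ d, t.eval θ = .const d → d ∈ doms := fun t ht d hd =>
    List.mem_filterMap.2 ⟨_, ht, Val.const?_eq_some.2 hd⟩
  have hcases : ∀ i, c i ∈ factConsts (bodyFacts r θ) ∨ (c i ∈ doms ∧ c i ∈ activeDomain D) := by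
    intro i
    have hi : i.1 < (harmlessVars P r).length := (ar_sym (R := R) hr) ▸ i.2
    have hx := hc i _ (List.getElem?_eq_getElem hi)
    obtain ⟨b, hb, hbx⟩ := (mem_harmlessVars.1 (List.getElem_mem hi)).1
    cases b with
    | rel a =>
      obtain ⟨l, hl⟩ := hbx
      refine Or.inl (mem_factConsts.2 ⟨_, mem_bodyFacts.2 ⟨a, hb, rfl⟩, l, ?_⟩)
      simpa [Atom.map, hl, Term.eval] using hx
    | dom t =>
      have ht : t = .var _ := hbx
      have hx' : t.eval θ = .const (c i) := by rw [ht]; exact hx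
      obtain ⟨d, hdD, hd⟩ := hθ.2 t hb
      rw [hx'] at hd
      rw [← Val.const.inj hd] at hdD
      exact Or.inr ⟨hdoms t hb _ hx', hdD⟩
  refine chase_of_entails {R.auxAtom j c'} _ rfl (factConsts (bodyFacts r θ) ++ doms) ?_ ?_ ?_ ?_
    ?_ ?_
  · have h1 := length_factConsts_le_maxVals hsmall
    have h2 : doms.length ≤ R.maxFacts :=
      (List.length_filterMap_le _ _).trans (R.length_body_le r hr)
    have h3 := R.maxVars_ge r hr
    rw [List.length_append]
    omega
  · intro a ha
    obtain rfl := Finset.mem_singleton.1 ha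
    exact Or.inr ⟨j, rfl⟩
  · rintro a (ha | rfl) i
    · obtain rfl := Finset.mem_singleton.1 ha
      exact List.mem_append_left _ ((mem_factConsts_iff_args hj hc').2 ⟨i, rfl⟩)
    · rcases hcases i with h | h
      · exact List.mem_append_left _ h
      · exact List.mem_append_right _ h.1
  · rintro a (ha | rfl) i
    · obtain rfl := Finset.mem_singleton.1 ha
      exact Or.inr (Or.inr ⟨_, ha, rfl, i, rfl⟩)
    · rcases hcases i with h | h
      · obtain ⟨i', hi'⟩ := (mem_factConsts_iff_args hj hc').1 h
        exact Or.inr (Or.inr ⟨R.auxAtom j c', by simp, rfl, i', hi'⟩)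
      · exact Or.inr (Or.inl h.2)
  · intro D' γ hγ hγD hmean
    obtain ⟨f, hf, hfΦ⟩ := (mean_pattern hj hc' γ).1 (hmean _ (Finset.mem_singleton_self _))
    have hev : ∀ t : Term C, (∀ d, t = .const d → d ∈ R.consts) →
        t.eval (fun x => f (θ x)) = f (t.eval θ) := by
      intro t ht
      cases t with
      | const d => simp only [Term.eval, hf, hγ d (ht d rfl)]
      | var x => rfl
    refine mean_aux.2 ?_
    rw [R.query_sym r hr]
    refine ⟨fun x => f (θ x), fun i x hx => ?_, fun b hb => ?_, fun t ht => ?_⟩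
    · change f (θ x) = _
      rw [hc i x hx, hf]
      rfl
    · convert hfΦ _ (mem_bodyFacts.2 ⟨b, hb, rfl⟩) using 1
      refine Atom.map_congr (g := fun t => f (Term.eval θ t)) fun i => hev _ fun d hd => ?_
      exact R.const_mem r hr d (Or.inl ⟨b, Or.inl hb, i, hd⟩)
    · obtain ⟨d, hdD, hd⟩ := hθ.2 t ht
      refine ⟨γ d, hγD d (List.mem_append_right _ (hdoms t ht d hd)) hdD, ?_⟩
      rw [hev t fun d' hd' => R.const_mem r hr d' (Or.inr (hd' ▸ ht)), hd, hf]
  · intro a ha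
    obtain rfl := Finset.mem_singleton.1 ha
    exact hd j hj c' hc'

open Classical in
/-- The facts that replace `Φ` when the firing of `r` with `θ` is undone: the facts of the firing
are removed, and the image of the ward is added. -/
noncomputable def resolve (R : Rewriting P) (r : Rule S C) (θ : ℕ → Val S C)
    (Φ : Finset (Atom S (Val S C))) : Finset (Atom S (Val S C)) :=
  Φ.filter (· ∉ r.headInst θ) ∪ ((R.ward r).map (Atom.map (Term.eval θ))).toFinset

theorem mem_resolve {r : Rule S C} {θ : ℕ → Val S C} {Φ : Finset (Atom S (Val S C))}
    {G : Atom S (Val S C)} : G ∈ R.resolve r θ Φ ↔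
      (G ∈ Φ ∧ G ∉ r.headInst θ) ∨ ∃ a ∈ R.ward r, a.map (Term.eval θ) = G := by
  classical
  simp [resolve]

theorem small_resolve {r : Rule S C} (hr : r ∈ P) {θ : ℕ → Val S C}
    {Φ : Finset (Atom S (Val S C))} (hΦ : R.Small Φ) {F : Atom S (Val S C)} (hF : F ∈ Φ)
    (hFr : F ∈ r.headInst θ) : R.Small (R.resolve r θ Φ) := by
  classical
  constructor
  · have h1 : (Φ.filter (· ∉ r.headInst θ)).card < Φ.card :=
      Finset.card_lt_card (Finset.filter_ssubset.2 ⟨F, hF, not_not.2 hFr⟩)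
    have h2 : ((R.ward r).map (Atom.map (Term.eval θ))).toFinset.card ≤ 1 :=
      (List.toFinset_card_le _).trans (by simpa using (R.isWardList r hr).length_le)
    have h3 := Finset.card_union_le (Φ.filter (· ∉ r.headInst θ))
      ((R.ward r).map (Atom.map (Term.eval θ))).toFinset
    have := hΦ.1
    unfold resolve
    omega
  · intro G hG
    rcases mem_resolve.1 hG with h | ⟨a, ha, rfl⟩
    · exact hΦ.2 G h.1
    · exact R.rel_mem r hr a ((R.isWardList r hr).mem_body a ha)

/-- Undoing a firing reflects satisfaction: a homomorphism of `resolve r θ Φ` into a chase over any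
database, together with a match of the body of `r` that agrees with it on the harmless variables,
yields a homomorphism of `Φ`. -/
theorem exists_hom_of_resolve {D : Set (Atom S C)} {r : Rule S C} (hr : r ∈ P)
    {θ : ℕ → Val S C} {Φ : Finset (Atom S (Val S C))}
    (hnull : ∀ G ∈ Φ, G ∉ r.headInst θ → ∀ i z, G.args i ≠ .null r z fun y => θ y.1)
    {γ : C → C} (hγ : ∀ c ∈ R.consts, γ c = c) {f : Val S C → Val S C}
    (hf : ∀ c, f (.const c) = .const (γ c)) (hfΦ : ∀ G ∈ R.resolve r θ Φ, G.map f ∈ chase P D)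
    {θ' : ℕ → Val S C} (hθ' : r.BodyHolds (chase P D) D θ')
    (hagree : ∀ x ∈ harmlessVars P r, θ' x = f (θ x)) :
    ∃ f' : Val S C → Val S C, (∀ c, f' (.const c) = .const (γ c)) ∧
      ∀ G ∈ Φ, G.map f' ∈ chase P D := by
  classical
  have hW := R.isWardList r hr
  let θ₁ := glue (R.ward r) (fun x => f (θ x)) θ'
  have hsat : r.BodyHolds (chase P D) D θ₁ := by
    refine hW.bodyHolds_glue (fun a ha => ?_) hθ' fun x hx hh => ?_
    · convert hfΦ _ (mem_resolve.2 (Or.inr ⟨a, ha, rfl⟩)) using 1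
      refine Atom.map_congr (g := fun t => f (Term.eval θ t)) fun i => ?_
      rcases hx : a.args i with c | x
      · have hc := R.const_mem r hr c (Or.inl ⟨a, Or.inl (hW.mem_body a ha), i, hx⟩)
        simp only [Term.eval, hf, hγ c hc]
      · rfl
    · obtain ⟨a, ha, i, hi⟩ := hx
      exact (hagree x (mem_harmlessVars.2 ⟨hW.inBody ha hi, hh⟩)).symm
  have hfr : ∀ x, r.Frontier x → θ₁ x = f (θ x) := by
    intro x hx
    by_cases hxW : ∃ a ∈ R.ward r, ∃ i, a.args i = .var x
    · exact glue_of_mem hxW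
    · exact (glue_of_not_mem hxW).trans
        (hagree x (mem_harmlessVars.2 ⟨hx.1, hW.not_harmful_of_frontier hx hxW⟩))
  -- The nulls of the firing undone go to the nulls of the firing with `θ₁`.
  let f' : Val S C → Val S C := fun v =>
    if h : ∃ z, v = .null r z fun y => θ y.1 then .null r h.choose fun y => θ₁ y.1 else f v
  have hf'null : ∀ z, f' (.null r z fun y => θ y.1) = .null r z fun y => θ₁ y.1 := by
    intro z
    have h : ∃ z', Val.null r z (fun y => θ y.1) = .null r z' fun y => θ y.1 := ⟨z, rfl⟩
    simp only [f', dif_pos h]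
    congr 1
    exact (Val.null.inj h.choose_spec).2.1.symm
  have hf'ne : ∀ v, (∀ z, v ≠ .null r z fun y => θ y.1) → f' v = f v := fun v hv =>
    dif_neg fun ⟨z, hz⟩ => hv z hz
  refine ⟨f', fun c => by rw [hf'ne _ (fun z hz => by cases hz), hf], fun G hG => ?_⟩
  by_cases hGr : G ∈ r.headInst θ
  · obtain ⟨a, ha, rfl⟩ := hGr
    refine chase_of_bodyHolds hr hsat ⟨a, ha, ?_⟩
    refine Atom.map_congr (f := fun t => f' (Term.eval (r.extend θ) t)) fun i => ?_
    rcases hx : a.args i with c | x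
    · have hc := R.const_mem r hr c (Or.inl ⟨a, Or.inr ha, i, hx⟩)
      simp only [Term.eval]
      rw [hf'ne _ (fun z hz => by cases hz), hf, hγ c hc]
    · simp only [Term.eval]
      by_cases hb : r.InBody x
      · have hxf : r.Frontier x := ⟨hb, a, ha, i, hx⟩
        rw [Rule.extend_of_inBody hb, Rule.extend_of_inBody hb, hfr x hxf]
        exact hf'ne _ fun z => Val.frontier_ne_null r z (fun y => θ y.1) ⟨x, hxf⟩
      · rw [Rule.extend_of_not_inBody hb, Rule.extend_of_not_inBody hb, hf'null]
  · convert hfΦ G (mem_resolve.2 (Or.inl ⟨hG, hGr⟩)) using 1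
    exact Atom.map_congr fun i => hf'ne _ (hnull G hG hGr i)

theorem derives_of_resolve {D : Set (Atom S C)} {r : Rule S C} (hr : r ∈ P) {θ : ℕ → Val S C}
    (hθ : r.BodyHolds (chase P D) D θ) {Φ : Finset (Atom S (Val S C))} (hsmall : R.Small Φ)
    {F : Atom S (Val S C)} (hF : F ∈ Φ) (hFr : F ∈ r.headInst θ)
    (hnull : ∀ G ∈ Φ, G ∉ r.headInst θ → ∀ i z, G.args i ≠ .null r z fun y => θ y.1)
    (hbody : R.Derives D (bodyFacts r θ)) (hres : R.Derives D (R.resolve r θ Φ)) :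
    R.Derives D Φ := by
  classical
  intro j hj c hc
  have hW := R.isWardList r hr
  have hsmall' := small_resolve hr hsmall hF hFr
  obtain ⟨j', hj'⟩ := R.exists_query_pattern _ hsmall'.1 hsmall'.2
  obtain ⟨c', hc'⟩ := exists_args hj'
  have hconst : ∀ x ∈ harmlessVars P r, ∃ d, θ x = .const d := fun x hx =>
    const_of_not_harmful hθ (mem_harmlessVars.1 hx).1 (mem_harmlessVars.1 hx).2
  have hex : ∀ i : Fin (R.ar (R.sym r)), ∃ d, θ ((harmlessVars P r).getD i.1 0) = .const d := by
    intro i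
    have hi : i.1 < (harmlessVars P r).length := (ar_sym (R := R) hr) ▸ i.2
    rw [List.getD_eq_getElem _ _ hi]
    exact hconst _ (List.getElem_mem hi)
  choose e he using hex
  have he' : ∀ (i : Fin (R.ar (R.sym r))) x, (harmlessVars P r)[i.1]? = some x →
      θ x = .const (e i) := fun i x hx => by
    rw [← he i, List.getD_eq_getElem?_getD, hx, Option.getD_some]
  have hidx : ∀ x ∈ harmlessVars P r, ∃ i : Fin (R.ar (R.sym r)),
      (harmlessVars P r)[i.1]? = some x := by
    intro x hx
    obtain ⟨i, hi, rfl⟩ := List.mem_iff_getElem.1 hx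
    exact ⟨⟨i, by rwa [ar_sym hr]⟩, List.getElem?_eq_getElem hi⟩
  have hQ := derives_body hr hθ hbody he'
  refine chase_of_entails {R.auxAtom j' c', R.auxAtom (R.sym r) e} _ rfl
    (factConsts Φ ++ factConsts (R.resolve r θ Φ) ++ List.ofFn e) ?_ ?_ ?_ ?_ ?_ ?_
  · have h1 := length_factConsts_le_maxVals hsmall
    have h2 := length_factConsts_le_maxVals hsmall'
    have h3 := R.maxVars_ge r hr
    have h4 := ar_sym (R := R) hr
    simp only [List.length_append, List.length_ofFn]
    omega
  · intro a ha
    rcases Finset.mem_insert.1 ha with rfl | ha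
    · exact Or.inr ⟨j', rfl⟩
    · obtain rfl := Finset.mem_singleton.1 ha
      exact Or.inr ⟨R.sym r, rfl⟩
  · rintro a (ha | rfl) i
    · rcases Finset.mem_insert.1 ha with rfl | ha
      · exact List.mem_append_left _ (List.mem_append_right _
          ((mem_factConsts_iff_args hj' hc').2 ⟨i, rfl⟩))
      · obtain rfl := Finset.mem_singleton.1 ha
        exact List.mem_append_right _ (List.mem_ofFn.2 ⟨i, rfl⟩)
    · exact List.mem_append_left _ (List.mem_append_left _
        ((mem_factConsts_iff_args hj hc).2 ⟨i, rfl⟩))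
  · have hres' : ∀ d ∈ factConsts (R.resolve r θ Φ), ∃ a' ∈ ({R.auxAtom j' c',
        R.auxAtom (R.sym r) e} : Finset (Atom R.schema C)), a'.rel.isRight ∧
        ∃ i', a'.args i' = d := by
      intro d hd
      obtain ⟨i', hi'⟩ := (mem_factConsts_iff_args hj' hc').1 hd
      exact ⟨R.auxAtom j' c', by simp, rfl, i', hi'⟩
    rintro a (ha | rfl) i
    · refine Or.inr (Or.inr ⟨a, ha, ?_, i, rfl⟩)
      rcases Finset.mem_insert.1 ha with rfl | ha
      · rfl
      · obtain rfl := Finset.mem_singleton.1 ha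
        rfl
    · have hi := (mem_factConsts_iff_args hj hc).2 ⟨i, rfl⟩
      suffices h : c i ∈ R.consts ∨ c i ∈ activeDomain D ∨ ∃ a' ∈ ({R.auxAtom j' c',
          R.auxAtom (R.sym r) e} : Finset (Atom R.schema C)), a'.rel.isRight ∧
          ∃ i', a'.args i' = c i from h
      obtain ⟨G, hG, l, hl⟩ := mem_factConsts.1 hi
      by_cases hGr : G ∈ r.headInst θ
      · -- A constant of a removed fact comes from the rule, the ward or a harmless variable.
        obtain ⟨b, hb, rfl⟩ := hGr
        rcases hx : b.args l with d | x
        · simp only [Atom.map, hx, Term.eval, Val.const.injEq] at hl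
          exact Or.inl (hl ▸ R.const_mem r hr d (Or.inl ⟨b, Or.inr hb, l, hx⟩))
        · simp only [Atom.map, hx, Term.eval] at hl
          by_cases hxb : r.InBody x
          · rw [Rule.extend_of_inBody hxb] at hl
            right
            right
            by_cases hxW : ∃ a ∈ R.ward r, ∃ i, a.args i = .var x
            · obtain ⟨w, hw, m, hm⟩ := hxW
              refine hres' _ (mem_factConsts.2 ⟨_, mem_resolve.2 (Or.inr ⟨w, hw, rfl⟩), m, ?_⟩)
              simpa [Atom.map, hm, Term.eval] using hl
            · obtain ⟨i', hi'⟩ := hidx x (mem_harmlessVars.2 ⟨hxb,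
                hW.not_harmful_of_frontier ⟨hxb, b, hb, l, hx⟩ hxW⟩)
              refine ⟨R.auxAtom (R.sym r) e, by simp, rfl, i', ?_⟩
              exact Val.const.inj ((he' i' x hi').symm.trans hl)
          · rw [Rule.extend_of_not_inBody hxb] at hl
            cases hl
      · exact Or.inr (Or.inr (hres' _ (mem_factConsts.2
          ⟨G, mem_resolve.2 (Or.inl ⟨hG, hGr⟩), l, hl⟩)))
  · intro D' γ hγ _ hmean
    obtain ⟨f, hf, hfΦ⟩ := (mean_pattern hj' hc' γ).1 (hmean _ (Finset.mem_insert_self _ _))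
    have hQ' := mean_aux.1 (hmean (R.auxAtom (R.sym r) e) (by simp))
    rw [R.query_sym r hr] at hQ'
    obtain ⟨θ', hθ', hbody'⟩ := hQ'
    refine (mean_pattern hj hc γ).2
      (exists_hom_of_resolve hr hnull hγ hf hfΦ hbody' fun x hx => ?_)
    obtain ⟨i, hi⟩ := hidx x hx
    rw [he' i x hi, hf]
    exact hθ' i x hi
  · intro a ha
    rcases Finset.mem_insert.1 ha with rfl | ha
    · exact hres j' hj' c' hc'
    · obtain rfl := Finset.mem_singleton.1 ha
      exact hQ

/-- The auxiliary rules derive the pattern of every small set of facts of the chase. -/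
theorem derives_of_subset_chaseLevel {D : Set (Atom S C)} (n : ℕ) :
    ∀ Φ : Finset (Atom S (Val S C)), R.Small Φ → (∀ F ∈ Φ, F ∈ chaseLevel P D n) →
      R.Derives D Φ := by
  classical
  induction n with
  | zero =>
    intro Φ
    induction Φ using Finset.induction_on with
    | empty => exact fun _ _ => derives_empty D
    | insert F Φ hF ih =>
      intro hsmall hΦ
      obtain ⟨F', hF', rfl⟩ := hΦ F (Finset.mem_insert_self _ _)
      refine derives_insert_database hF' hsmall (ih ⟨?_, fun G hG => ?_⟩ fun G hG => ?_)
      · exact (Finset.card_le_card (Finset.subset_insert _ _)).trans hsmall.1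
      · exact hsmall.2 G (Finset.mem_insert_of_mem hG)
      · exact hΦ G (Finset.mem_insert_of_mem hG)
  | succ n ih =>
    -- Inner induction on the number of facts of `Φ` that are new in round `n + 1`.
    intro Φ
    induction hm : (Φ.filter (· ∉ chaseLevel P D n)).card using Nat.strong_induction_on
      generalizing Φ with
    | _ m ihm =>
      intro hsmall hΦ
      by_cases hall : ∀ F ∈ Φ, F ∈ chaseLevel P D n
      · exact ih Φ hsmall hall
      push Not at hall
      obtain ⟨F, hF, hFn⟩ := hall
      obtain ⟨r, hr, θ, hb, hFr⟩ := (hΦ F hF).resolve_left hFn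
      have hward : ∀ a ∈ R.ward r, a.map (Term.eval θ) ∈ chaseLevel P D n := fun a ha =>
        hb.1 a ((R.isWardList r hr).mem_body a ha)
      refine derives_of_resolve hr (hb.mono (chaseLevel_subset_chase n)) hsmall hF hFr
        (fun G hG hGr i z hi => hGr (mem_headInst_of_null hFr hFn (hΦ G hG) hi))
        (ih _ (small_bodyFacts hr θ) fun G hG => ?_)
        (ihm _ ?_ (R.resolve r θ Φ) rfl (small_resolve hr hsmall hF hFr) fun G hG => ?_)
      · obtain ⟨a, ha, rfl⟩ := mem_bodyFacts.1 hG
        exact hb.1 a ha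
      · rw [← hm]
        refine Finset.card_lt_card ⟨fun G hG => ?_, fun h => ?_⟩
        · obtain ⟨hG, hGn⟩ := Finset.mem_filter.1 hG
          rcases mem_resolve.1 hG with h | ⟨a, ha, rfl⟩
          · exact Finset.mem_filter.2 ⟨h.1, hGn⟩
          · exact absurd (hward a ha) hGn
        · obtain ⟨hF', -⟩ := Finset.mem_filter.1 (h (Finset.mem_filter.2 ⟨hF, hFn⟩))
          rcases mem_resolve.1 hF' with h | ⟨a, ha, rfl⟩
          · exact h.2 hFr
          · exact hFn (hward a ha)
      · rcases mem_resolve.1 hG with h | ⟨a, ha, rfl⟩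
        · exact hΦ G h.1
        · exact Or.inl (hward a ha)

variable (R) in
theorem equivalent_program : Equivalent P R.program := by
  intro D
  refine ⟨R.tr, fun c => rfl, fun v hv => ?_, ?_, ?_⟩
  · cases v with
    | const c => cases hv
    | null r z σ => trivial
  · rintro v ⟨F, hF, i, rfl⟩ w ⟨G, hG, l, rfl⟩ h
    exact tr_injOn (Chase.over hF i) (Chase.over hG l) h
  · ext F
    constructor
    · rintro ⟨G, hG, rfl⟩
      refine chase_tr (fun r hr θ hθ c hc => ?_) hG
      obtain ⟨n, hn⟩ := hθ.exists_chaseLevel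
      refine derives_body hr hθ
        (derives_of_subset_chaseLevel n _ (small_bodyFacts hr θ) fun G hG => ?_) hc
      obtain ⟨a, ha, rfl⟩ := mem_bodyFacts.1 hG
      exact hn.1 a ha
    · intro hF
      obtain ⟨G, hG, rfl⟩ := mean_lift.1 (mean_of_chase hF)
      exact ⟨G, hG, rfl⟩

end Rewriting

end Completeness

/-! ### Existence of the rewriting -/

section Existence

variable {S : Schema.{u}} {C : Type v} {P : Set (Rule S C)}

theorem Rule.finite_bodyAtoms (r : Rule S C) :
    {b : Atom S (Term C) | .rel b ∈ r.body}.Finite :=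
  (List.finite_toSet r.body).preimage fun _ _ _ _ h => BodyAtom.rel.inj h

theorem Rule.finite_consts (r : Rule S C) : {c | r.HasConst c}.Finite := by
  have hA : {a : Atom S (Term C) | .rel a ∈ r.body ∨ a ∈ r.head}.Finite :=
    r.finite_bodyAtoms.union (List.finite_toSet r.head)
  have hd : ((fun c => BodyAtom.dom (.const c)) ⁻¹' {b | b ∈ r.body} : Set C).Finite :=
    (List.finite_toSet r.body).preimage fun _ _ _ _ h => Term.const.inj (BodyAtom.dom.inj h)
  refine ((hA.biUnion fun a _ => (Set.finite_range a.args).preimage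
    (f := Term.const) fun _ _ _ _ h => Term.const.inj h).union hd).subset ?_
  rintro c (⟨a, ha, i, hi⟩ | h)
  · exact Or.inl (Set.mem_biUnion ha ⟨i, hi⟩)
  · exact Or.inr h

theorem exists_forall_le_of_finite {α : Type w} {s : Set α} (hs : s.Finite) (f : α → ℕ) :
    ∃ n, ∀ a ∈ s, f a ≤ n := by
  obtain ⟨n, hn⟩ := (hs.image f).bddAbove
  exact ⟨n, fun a ha => hn ⟨a, ha, rfl⟩⟩

theorem exists_rewriting (hfin : P.Finite) (hward : Warded P) : Nonempty (Rewriting P) := by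
  classical
  have hW : ∀ r, ∃ W, r ∈ P → IsWardList P r W := fun r => by
    by_cases hr : r ∈ P
    · obtain ⟨W, hW⟩ := hward.exists_isWardList hr
      exact ⟨W, fun _ => hW⟩
    · exact ⟨[], fun h => absurd h hr⟩
  choose ward hward' using hW
  let rels : Set S.Rel := ⋃ r ∈ P, Atom.rel '' {b : Atom S (Term C) | .rel b ∈ r.body}
  have hrels : rels.Finite := hfin.biUnion fun r _ => r.finite_bodyAtoms.image _
  let consts : Set C := ⋃ r ∈ P, {c | r.HasConst c}
  have hconsts : consts.Finite := hfin.biUnion fun r _ => r.finite_consts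
  obtain ⟨N, hN⟩ := exists_forall_le_of_finite hfin fun r => r.body.length
  obtain ⟨A, hA⟩ := exists_forall_le_of_finite hrels S.arity
  obtain ⟨H, hH⟩ := exists_forall_le_of_finite hfin fun r => (harmlessVars P r).length
  let atoms : Set (Atom S (ℕ ⊕ ℕ)) := {a | a.rel ∈ rels ∧
    ∀ i, a.args i ∈ (Sum.inl '' Set.Iio (N * A) ∪ Sum.inr '' Set.Iio (N * A) : Set (ℕ ⊕ ℕ))}
  have hatoms : atoms.Finite := finite_setOf_atom hrels
    (((Set.finite_Iio _).image _).union ((Set.finite_Iio _).image _))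
  let queries : Set (Query S C) :=
    Set.image2 Query.pattern (Set.Iic (N * A)) {q | q ⊆ atoms} ∪ Query.body '' P
  have hqueries : queries.Finite :=
    ((Set.finite_Iic _).image2 _ hatoms.finite_subsets).union (hfin.image _)
  have : Finite queries := hqueries.to_subtype
  obtain ⟨k, ⟨e⟩⟩ := Finite.exists_equiv_fin queries
  have hsurj : ∀ q ∈ queries, ∃ j, (e.symm j : Query S C) = q := fun q hq =>
    ⟨e ⟨q, hq⟩, by simp⟩
  obtain ⟨j₀, -⟩ := hsurj (.pattern 0 ∅)
    (Or.inl ⟨0, Nat.zero_le _, ∅, Set.empty_subset _, rfl⟩)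
  have hsym : ∀ r, ∃ j, r ∈ P → (e.symm j : Query S C) = .body r := fun r => by
    by_cases hr : r ∈ P
    · obtain ⟨j, hj⟩ := hsurj (.body r) (Or.inr ⟨r, hr, rfl⟩)
      exact ⟨j, fun _ => hj⟩
    · exact ⟨j₀, fun h => absurd h hr⟩
  choose sym hsym' using hsym
  have hvals : ∀ Φ : Finset (Atom S (Val S C)), Φ.card ≤ N → (∀ F ∈ Φ, F.rel ∈ rels) →
      (factVals Φ).length ≤ N * A := fun Φ hΦ hrel =>
    length_factVals_le hΦ fun F hF => hA _ (hrel F hF)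
  exact ⟨{
    k := k
    query := fun j => (e.symm j : Query S C)
    ward := ward
    isWardList := fun r hr => hward' r hr
    sym := sym
    query_sym := fun r hr => hsym' r hr
    rels := rels
    finite_rels := hrels
    rel_mem := fun r hr b hb => Set.mem_biUnion hr ⟨b, hb, rfl⟩
    consts := consts
    finite_consts := hconsts
    const_mem := fun r hr c hc => Set.mem_biUnion hr hc
    maxFacts := N
    length_body_le := hN
    maxVals := N * A
    length_vals_le := hvals
    exists_query_pattern := fun Φ hΦ hrel => hsurj _ <| Or.inl
      ⟨_, (length_factConsts_le Φ).trans (hvals Φ hΦ hrel), _, by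
        rintro _ ⟨F, hF, rfl⟩
        refine ⟨hrel F hF, fun i => ?_⟩
        change encode Φ (F.args i) ∈ _
        rcases hv : F.args i with c | ⟨r, z, σ⟩
        · exact Or.inl ⟨_, (List.idxOf_lt_length_iff.2 (mem_factConsts.2 ⟨F, hF, i, hv⟩)).trans_le
            ((length_factConsts_le Φ).trans (hvals Φ hΦ hrel)), rfl⟩
        · exact Or.inr ⟨_, (List.idxOf_lt_length_iff.2 (mem_factVals.2 ⟨F, hF, i, hv⟩)).trans_le
            (hvals Φ hΦ hrel), rfl⟩, rfl⟩
    maxVars := 2 * (N * A) + N + H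
    maxVars_ge := fun r hr => Nat.add_le_add_left (hH r hr) _
    maxVals_le := by omega }⟩

end Existence

end DatalogPM

theorem mainTheorem1 {S : DatalogPM.Schema} {C : Type*}
    (P : Set (DatalogPM.Rule S C)) (hfin : P.Finite) (hward : DatalogPM.Warded P) :
    ∃ (k : ℕ) (ar : Fin k → ℕ) (P' : Set (DatalogPM.Rule (S.withAux ar) C)),
      P'.Finite ∧ DatalogPM.HarmlessWarded P' ∧ DatalogPM.Equivalent P P' := by
  obtain ⟨R⟩ := DatalogPM.exists_rewriting hfin hward
  exact ⟨R.k, R.ar, R.program, R.finite_program hfin, R.harmlessWarded_program,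
    R.equivalent_program⟩
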